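/- Let $d\ge 1$ and let $M\subset\mathbb{R}^d$ be a fluid domain (taken closed) that is meshed by convex polytopes. A mesh $\mathbb{M}$ on $M$ consists of finitely many convex polytopes $C_1,\dots,C_N$ with nonempty, pairwise disjoint interiors and with union $M$. Two distinct cells $C_i,C_j$ share the hyperface $D_{ij}=C_i\cap C_j$ if this set has positive $(d-1)$-dimensional measure; $N(i)$ is the set consisting of $i$ and of all $j$ such that $C_j$ shares a hyperface with $C_i$; $\mathbf{n}_{ij}$ is the unit normal on $D_{ij}$ pointing from $C_i$ to $C_j$. Write $\Omega_{ii}=\operatorname{Vol}(C_i)$, $\mathbf{x}_i$ for the barycenter of $C_i$, $\mathbf{x}_{ij}$ for the barycenter of $D_{ij}$, $h_{C_i}$ for the diameter of $C_i$, and $\rho_{C_i}$ for the diameter of the largest ball inscribed in $C_i$. For a function $f$ on $M$ and $F\in\mathbb{R}^N$ let $$(P_{\mathbb{M}}(f))_i=\frac1{\Omega_{ii}}\int_{C_i}f\,{\rm d}\mathbf{x},\qquad (S_{\mathbb{M}}(F))(\mathbf{x})=F_i\ \text{ if } \mathbf{x}\in C_i ,$$ and let $\mathcal{S}$ be the space of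 real $N\times N$ matrices $A$ with $\sum_jA_{ij}=0$ for all $i$ and $A_{ij}=0$ for all $j\notin N(i)$. Let $\{\mathbb{M}_h\}$ be a family of meshes on $M$, indexed by a set of values of the mesh size $h=\max_i h_{C_i}$. Assume that the family is quasi-uniform, i.e. there are constants $\sigma,\gamma$ independent of $h$ with $h_{C_i}/\rho_{C_i}\le\sigma$ and $h/h_{C_i}\le\gamma$ for every cell $C_i$ of every $\mathbb{M}_h$, and that for some $\alpha\ge1$ and some $\lambda$ independent of $h$ $$\left|\frac{\mathbf{x}_i+\mathbf{x}_j}{2}-\mathbf{x}_{ij}\right|\le\lambda h^{1+\alpha}$$ for any two cells $C_i,C_j$ of $\mathbb{M}_h$ that share a hyperface. Let $\mathbf{u}\in W^{2,\infty}(M)$ be a vector field (represented by a function that is continuous on $M$) that is tangent to the boundary, i.e. $\mathbf{u}\cdot\mathbf{n}=0$ at all points of $\partial M$ that have an outer normal $\mathbf{n}$. Define the matrix $A_h^{\mathbf{u}}$ by $$(A_h^{\mathbf{u}})_{ii}=\frac1{2\Omega_{ii}}\int_{C_i}\operatorname{div}\mathbf{u}\,{\rm d}\mathbf{x},\qquad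 (A_h^{\mathbf{u}})_{ij}=-\frac1{2\Omega_{ii}}\int_{D_{ij}}(\mathbf{u}\cdot\mathbf{n}_{ij})\,{\rm d}S\quad (j\in N(i),\ j\ne i),$$ and $(A_h^{\mathbf{u}})_{ij}=0$ for $j\notin N(i)$. Then $A_h^{\mathbf{u}}\in\mathcal{S}$ for every $h$, and for every $f\in C^2(M)$ $$\left\|S_{\mathbb{M}_h}\left(A_h^{\mathbf{u}}P_{\mathbb{M}_h}(f)\right)-(-\mathbf{d}f\cdot\mathbf{u})\right\|_{L^\infty(M)}\longrightarrow0\quad\text{as } h\to0 .$$ Moreover, there is a constant $C$ independent of $h$ such that this norm is at most $C(h+h^\alpha)$ for every $h$. -/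

import Mathlib

open Set Filter Topology MeasureTheory
open scoped ENNReal ContDiff RealInnerProductSpace Matrix

noncomputable section

namespace DiscreteFlow

/-- Euclidean space of dimension `d`. -/
abbrev Euc (d : ℕ) : Type := EuclideanSpace ℝ (Fin d)

variable {d : ℕ}

/-! ### Vector fields of class `W^{2,∞}` on a domain -/

/-- `w` is the weak partial derivative `∂v/∂xₖ` on the open set `U`, tested against smooth functions
with compact support in `U`. -/
def IsWeakPartial (U : Set (Euc d)) (k : Fin d) (v w : Euc d → Euc d) : Prop :=
  ∀ φ : Euc d → ℝ, ContDiff ℝ ∞ φ → HasCompactSupport φ → tsupport φ ⊆ U →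
    ∫ x in U, fderiv ℝ φ x (EuclideanSpace.single k 1) • v x = -∫ x in U, φ x • w x

/-- `u ∈ W^{2,∞}(U)`: the vector field `u` and its weak partial derivatives of orders one and two
are in `L^∞(U)`. -/
def MemW2Infty (U : Set (Euc d)) (u : Euc d → Euc d) : Prop :=
  MemLp u ∞ (volume.restrict U) ∧
  ∃ (Du : Fin d → Euc d → Euc d) (D2u : Fin d → Fin d → Euc d → Euc d),
    (∀ k, MemLp (Du k) ∞ (volume.restrict U) ∧ IsWeakPartial U k u (Du k)) ∧
    (∀ k l, MemLp (D2u k l) ∞ (volume.restrict U) ∧ IsWeakPartial U l (Du k) (D2u k l))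

/-- The divergence of `u`, the trace of its derivative. (The continuous representative of a field
of class `W^{2,∞}` is continuously differentiable in the interior of the domain.) -/
def divergence (u : Euc d → Euc d) (x : Euc d) : ℝ :=
  LinearMap.trace ℝ (Euc d) (fderiv ℝ u x : Euc d →ₗ[ℝ] Euc d)

/-- `n` is the outer unit normal of `M` at the boundary point `x`: near `x`, the set `M` is the
half-space through `x` with outer normal `n`. For a polyhedral `M` this applies to all points of
`∂M` except those of its edges and corners, where there is no normal. -/
def IsOuterUnitNormal (M : Set (Euc d)) (x n : Euc d) : Prop :=
  ‖n‖ = 1 ∧ ∀ᶠ y in 𝓝 x, (y ∈ M ↔ ⟪n, y - x⟫ ≤ 0)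

/-- `u · n = 0` on the boundary of `M`. -/
def TangentToBoundary (M : Set (Euc d)) (u : Euc d → Euc d) : Prop :=
  ∀ x n, IsOuterUnitNormal M x n → ⟪u x, n⟫ = 0

/-! ### Meshes -/

/-- A convex polytope with nonempty interior: a bounded intersection of finitely many closed
half-spaces. -/
def IsConvexBodyPolytope (C : Set (Euc d)) : Prop :=
  Bornology.IsBounded C ∧ (interior C).Nonempty ∧
    ∃ (m : ℕ) (a : Fin m → Euc d) (b : Fin m → ℝ), C = {x | ∀ k, ⟪a k, x⟫ ≤ b k}

/-- A mesh on `M`: finitely many convex polytopes with pairwise disjoint interiors and union `M`. -/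
structure Mesh (M : Set (Euc d)) where
  /-- the number of cells -/
  N : ℕ
  /-- the cells -/
  cell : Fin N → Set (Euc d)
  polytope : ∀ i, IsConvexBodyPolytope (cell i)
  disjoint_interior : ∀ i j, i ≠ j → Disjoint (interior (cell i)) (interior (cell j))
  cover : ⋃ i, cell i = M

/-- The diameter `ρ_C` of the largest ball inscribed in `C`. -/
def inscribedDiam (C : Set (Euc d)) : ℝ :=
  sSup {ρ : ℝ | 0 ≤ ρ ∧ ∃ x, Metric.closedBall x (ρ / 2) ⊆ C}

/-- The surface measure: `(d-1)`-dimensional Hausdorff measure, normalized so that it is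
`(d-1)`-dimensional Lebesgue measure on every hyperplane. -/
def surf (d : ℕ) : Measure (Euc d) := Measure.euclideanHausdorffMeasure (d - 1)

namespace Mesh

variable {M : Set (Euc d)} (𝓜 : Mesh M)

/-- The mesh size `h`, the largest diameter of a cell. -/
def size : ℝ := ⨆ i, Metric.diam (𝓜.cell i)

/-- The volume `Ω_ii` of cell `i`. -/
def vol (i : Fin 𝓜.N) : ℝ := volume.real (𝓜.cell i)

/-- The hyperface `D_ij` common to the cells `i` and `j`. -/
def face (i j : Fin 𝓜.N) : Set (Euc d) := 𝓜.cell i ∩ 𝓜.cell j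

/-- The distinct cells `i`, `j` share a hyperface: the common part of their boundaries is
`(d-1)`-dimensional. -/
def Adj (i j : Fin 𝓜.N) : Prop := i ≠ j ∧ 0 < surf d (𝓜.face i j)

/-- The index set `N(i)`, which contains `i`. -/
def nbhd (i : Fin 𝓜.N) : Set (Fin 𝓜.N) := {j | j = i ∨ 𝓜.Adj i j}

/-- The barycenter of cell `i`. -/
def cellBary (i : Fin 𝓜.N) : Euc d := ⨍ x in 𝓜.cell i, x

/-- The barycenter of the hyperface `D_ij`. -/
def faceBary (i j : Fin 𝓜.N) : Euc d := ⨍ x in 𝓜.face i j, x ∂(surf d)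

/-- `n` is a unit vector normal to a hyperplane that separates cell `i` from cell `j`, and points
from `i` to `j`. -/
def IsNormal (i j : Fin 𝓜.N) (n : Euc d) : Prop :=
  ‖n‖ = 1 ∧ ∃ c : ℝ, (∀ x ∈ 𝓜.cell i, ⟪n, x⟫ ≤ c) ∧ (∀ x ∈ 𝓜.cell j, c ≤ ⟪n, x⟫)

/-- The unit normal `n_ij` on `D_ij` that points from cell `i` to cell `j`. (If the two cells share
a hyperface, the separating hyperplane is the one that contains `D_ij`, so exactly one vector has
the property `IsNormal`.) -/
def normal (i j : Fin 𝓜.N) : Euc d := Classical.epsilon (𝓜.IsNormal i j)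

/-- The flux of `u` through `D_ij` from cell `i` to cell `j`. -/
def flux (u : Euc d → Euc d) (i j : Fin 𝓜.N) : ℝ :=
  ∫ x in 𝓜.face i j, ⟪u x, 𝓜.normal i j⟫ ∂(surf d)

open Classical in
/-- The matrix `A_h^u`. -/
def velocityMatrix (u : Euc d → Euc d) : Matrix (Fin 𝓜.N) (Fin 𝓜.N) ℝ :=
  Matrix.of fun i j =>
    if i = j then 1 / (2 * 𝓜.vol i) * ∫ x in 𝓜.cell i, divergence u x
    else if 𝓜.Adj i j then -(1 / (2 * 𝓜.vol i)) * 𝓜.flux u i j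
    else 0

/-- The space `𝒮` of matrices `A` with `A·1 = 0` and `A_ij = 0` for `j ∉ N(i)`. -/
def sparse : Set (Matrix (Fin 𝓜.N) (Fin 𝓜.N) ℝ) :=
  {A | A *ᵥ (fun _ => 1) = 0 ∧ ∀ i j, j ∉ 𝓜.nbhd i → A i j = 0}

/-- The operator `P`: the vector of cell averages of `f`. -/
def proj (f : Euc d → ℝ) (i : Fin 𝓜.N) : ℝ := 1 / 𝓜.vol i * ∫ x in 𝓜.cell i, f x

open Classical in
/-- The operator `S`: the piecewise constant function with value `F i` on cell `i`. (At the points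
of several cells, which form a null set, it has the value of one of them.) -/
def recon (F : Fin 𝓜.N → ℝ) (x : Euc d) : ℝ :=
  if hx : ∃ i, x ∈ 𝓜.cell i then F hx.choose else 0

/-- The `L^∞(M)` norm of `S(A_h^u P(f)) - (-df·u)`. -/
def consistencyError (u : Euc d → Euc d) (f : Euc d → ℝ) : ℝ≥0∞ :=
  eLpNorm (fun x => 𝓜.recon (𝓜.velocityMatrix u *ᵥ 𝓜.proj f) x - -(fderivWithin ℝ f M x (u x)))
    ∞ (volume.restrict M)

end Mesh

/-- The family of meshes is shape-regular. -/
def ShapeRegular {M : Set (Euc d)} {H : Type*} (mesh : H → Mesh M) : Prop :=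
  ∃ σ : ℝ, ∀ h i, Metric.diam ((mesh h).cell i) / inscribedDiam ((mesh h).cell i) ≤ σ

/-- The family of meshes is quasi-uniform. -/
def QuasiUniform {M : Set (Euc d)} {H : Type*} (mesh : H → Mesh M) : Prop :=
  ShapeRegular mesh ∧
    ∃ γ : ℝ, ∀ h i, (mesh h).size / Metric.diam ((mesh h).cell i) ≤ γ

/-- The approximate-parallelogram condition with exponent `α`: for any two cells that share a
hyperface, the midpoint of their barycenters is within `lam * h^(1+α)` of the barycenter of the
hyperface. -/
def ApproxParallelogram {M : Set (Euc d)} {H : Type*} (mesh : H → Mesh M) (α : ℝ) : Prop :=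
  ∃ lam : ℝ, ∀ h i j, (mesh h).Adj i j →
    ‖(1 / 2 : ℝ) • ((mesh h).cellBary i + (mesh h).cellBary j) - (mesh h).faceBary i j‖
      ≤ lam * (mesh h).size ^ (1 + α)

end DiscreteFlow

end

open scoped NNReal

noncomputable section

namespace DiscreteFlow

variable {d : ℕ}

/-! The discrete operator is a centred finite-volume scheme, and the proof is a Taylor expansion
closed up by two applications of the divergence theorem. Since `u` is tangent to the boundary, the
integral of `div u` over a cell is the sum of its fluxes through the hyperfaces
(`integral_divergence_cell`). Hence the rows of the matrix sum to zero, and row `i` applied to `F`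
is `-1/(2Ω_ii) ∑ⱼ flux_ij (F_j - F_i)`.

Let `F = P(f)`, let `g` be the derivative of `f` at the barycenter `x_i`, and let `p` be the
barycenter of `D_ij`. A cell average of an affine function is its value at the barycenter, so `F_j -
F_i` is `f'(p)(x_j - x_i)` up to `O(h²)`. As `p` is within `O(h^(1+α))` of the midpoint, this is `2
g(p - x_i) + O(h² + h^(1+α))` (`abs_proj_sub_proj_le`). Next, `flux_ij · g(p - x_i)` is the flux of
`w(x) = g(x - x_i) u(x)` up to `O(h²)` times the area of the hyperface, because `g(p - x)` has mean
zero there (`abs_flux_mul_sub_le`). The field `w` is again tangent, so its fluxes add up to the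
integral of `div w = g(x - x_i) div u + g(u)`, which is `Ω_ii g(u(x_i)) + O(h Ω_ii)`
(`abs_integral_divergence_smul_sub_le`). The factors 2 cancel and `-g(u(x_i))` remains.

The face errors are harmless because `h` times the area of all hyperfaces of a cell is `O(Ω_ii)`:
the divergence theorem for `x - z`, with `z` the center of an inscribed ball, bounds the area
(`mul_sum_surf_face_le`), and quasi-uniformity makes the radius comparable to `h`.

Two foundations are proved on the way. A continuous field with bounded weak derivatives is Lipschitz
on convex sets, by mollification (`exists_lipschitzOnWith_of_isWeakPartial`). The divergence theorem
for Lipschitz fields on polytopes (`IsPolytopeWith.integral_divergence`) comes from Fubini along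
lines, each of which generically enters and leaves the polytope once or misses it. -/

/-! ### Surface measure on hyperplanes and Fubini in an oblique direction -/

/-- The hyperplane with normal `n` at level `t`. -/
def hyperplane (n : Euc d) (t : ℝ) : Set (Euc d) := {x | ⟪n, x⟫ = t}

lemma isClosed_hyperplane (n : Euc d) (t : ℝ) : IsClosed (hyperplane n t) :=
  isClosed_eq (by fun_prop) continuous_const

lemma finrank_orthogonal_unit {n : Euc d} (hn : ‖n‖ = 1) :
    Module.finrank ℝ (ℝ ∙ n)ᗮ = d - 1 := by
  have h0 : n ≠ 0 := by rintro rfl; simp at hn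
  have h1 := (ℝ ∙ n).finrank_add_finrank_orthogonal
  rw [finrank_span_singleton h0, finrank_euclideanSpace_fin] at h1
  omega

/-- The isometric parametrization of a hyperplane by its direction. -/
def hyperplaneParam (n : Euc d) (t : ℝ) (v : (ℝ ∙ n)ᗮ) : Euc d := v + t • n

lemma isometry_hyperplaneParam (n : Euc d) (t : ℝ) : Isometry (hyperplaneParam n t) := by
  refine Isometry.of_dist_eq fun a b => ?_
  simp [hyperplaneParam, Subtype.dist_eq]

lemma range_hyperplaneParam {n : Euc d} (hn : ‖n‖ = 1) (t : ℝ) :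
    range (hyperplaneParam n t) = hyperplane n t := by
  ext x
  constructor
  · rintro ⟨v, rfl⟩
    have := Submodule.mem_orthogonal_singleton_iff_inner_right.1 v.2
    simp [hyperplane, hyperplaneParam, inner_add_right, inner_smul_right, this, hn]
  · intro hx
    refine ⟨⟨x - t • n, Submodule.mem_orthogonal_singleton_iff_inner_right.2 ?_⟩, ?_⟩
    · have : ⟪n, x⟫ = t := hx
      simp [inner_sub_right, inner_smul_right, hn, this]
    · simp [hyperplaneParam]

/-- Hausdorff measure is transported by the isometric parametrization, and on a Euclidean space of
dimension `d - 1` it is Lebesgue measure. All surface integrals are computed through this. -/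
lemma surf_restrict_hyperplane {n : Euc d} (hn : ‖n‖ = 1) (t : ℝ) :
    (surf d).restrict (hyperplane n t) = (volume : Measure (ℝ ∙ n)ᗮ).map (hyperplaneParam n t) := by
  rw [← range_hyperplaneParam hn, surf, ← finrank_orthogonal_unit hn,
    ← (isometry_hyperplaneParam n t).map_euclideanHausdorffMeasure,
    InnerProductSpace.euclideanHausdorffMeasure_eq_volume]

lemma sfinite_surf_restrict {n : Euc d} (hn : ‖n‖ = 1) (t : ℝ) :
    SFinite ((surf d).restrict (hyperplane n t)) := by
  rw [surf_restrict_hyperplane hn]; infer_instance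

lemma measurePreserving_add_orthogonal {V : Type*} [NormedAddCommGroup V] [InnerProductSpace ℝ V]
    [FiniteDimensional ℝ V] [MeasurableSpace V] [BorelSpace V] (s : Submodule ℝ V) (p : V) :
    MeasurePreserving (fun q : s × sᗮ => (q.1 : V) + q.2 + p) (volume.prod volume) volume := by
  have h0 : MeasurePreserving (s.measurableEquivProd p) volume (volume.prod volume) := by
    rw [← InnerProductSpace.euclideanHausdorffMeasure_eq_volume (V := V)]
    exact s.measurePreserving_measurableEquivProd p
  have h1 := MeasurePreserving.symm (s.measurableEquivProd p) h0
  have h2 : (fun q : s × sᗮ => (q.1 : V) + q.2 + p) = (s.measurableEquivProd p).symm := by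
    ext1 q
    simp
  rw [h2]
  exact h1

lemma measurePreserving_orthogonal_add {n : Euc d} (hn : ‖n‖ = 1) (t : ℝ) :
    MeasurePreserving (fun p : ℝ × (ℝ ∙ n)ᗮ => hyperplaneParam n t p.2 + p.1 • n)
      (volume.prod volume) volume := by
  have h1 := measurePreserving_add_orthogonal (ℝ ∙ n) (t • n)
  let L : ℝ ≃ₗᵢ[ℝ] (ℝ ∙ n) := LinearIsometryEquiv.toSpanUnitSingleton n hn
  have hL : MeasurePreserving L volume volume := L.measurePreserving
  have h2 : MeasurePreserving (Prod.map L (id : (ℝ ∙ n)ᗮ → (ℝ ∙ n)ᗮ))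
      (volume.prod volume) (volume.prod volume) := hL.prod (.id _)
  have h3 := h1.comp h2
  have h4 : (fun p : ℝ × (ℝ ∙ n)ᗮ => hyperplaneParam n t p.2 + p.1 • n) =
      (fun q : (ℝ ∙ n) × (ℝ ∙ n)ᗮ => (q.1 : Euc d) + q.2 + t • n) ∘
        Prod.map L id := by
    ext1 p
    change (p.2 : Euc d) + t • n + p.1 • n = p.1 • n + p.2 + t • n
    abel
  rw [h4]
  exact h3

/-- Split `e = k n + e'` with `e'` parallel to the hyperplane. The shear along `e'` preserves
measure, and the component along `n` contributes the Jacobian `|k|`. -/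
lemma measurePreserving_hyperplane_add {n : Euc d} (hn : ‖n‖ = 1) (t : ℝ) {e : Euc d}
    (he : ⟪n, e⟫ ≠ 0) :
    MeasurePreserving (fun p : ℝ × Euc d => p.2 + p.1 • e)
      ((ENNReal.ofReal |⟪n, e⟫| • volume).prod ((surf d).restrict (hyperplane n t))) volume := by
  set k := ⟪n, e⟫ with hk
  let e' : (ℝ ∙ n)ᗮ := ⟨e - k • n, Submodule.mem_orthogonal_singleton_iff_inner_right.2 (by
    simp [inner_sub_right, inner_smul_right, hn, hk])⟩
  have h1 : MeasurePreserving (fun s : ℝ => k * s) (ENNReal.ofReal |k| • volume) volume :=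
    ⟨by fun_prop, by rw [Measure.map_smul]; exact Real.smul_map_volume_mul_left he⟩
  have h2 : MeasurePreserving (fun p : ℝ × (ℝ ∙ n)ᗮ => (k * p.1, p.2 + p.1 • e'))
      ((ENNReal.ofReal |k| • volume).prod volume) (volume.prod volume) :=
    h1.skew_product (g := fun s v => v + s • e') (by fun_prop)
      (ae_of_all _ fun s => (measurePreserving_add_right volume (s • e')).map_eq)
  have h3 := (measurePreserving_orthogonal_add hn t).comp h2
  have hm : Measurable (hyperplaneParam n t) := (isometry_hyperplaneParam n t).continuous.measurable
  have := sfinite_surf_restrict hn t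
  have h4 : MeasurePreserving (Prod.map (id : ℝ → ℝ) (hyperplaneParam n t))
      ((ENNReal.ofReal |k| • volume).prod volume)
      ((ENNReal.ofReal |k| • volume).prod ((surf d).restrict (hyperplane n t))) :=
    (MeasurePreserving.id _).prod ⟨hm, (surf_restrict_hyperplane hn t).symm⟩
  refine ⟨by fun_prop, ?_⟩
  rw [← h4.map_eq, Measure.map_map (by fun_prop) h4.measurable, ← h3.map_eq]
  congr 1
  ext1 p
  change (p.2 : Euc d) + t • n + p.1 • e =
    ((p.2 + p.1 • e' : (ℝ ∙ n)ᗮ) : Euc d) + t • n + (k * p.1) • n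
  rw [Submodule.coe_add, Submodule.coe_smul]
  change (p.2 : Euc d) + t • n + p.1 • e = p.2 + p.1 • (e - k • n) + t • n + (k * p.1) • n
  module

lemma surf_lt_top_of_isBounded {n : Euc d} (hn : ‖n‖ = 1) {t : ℝ} {A : Set (Euc d)}
    (hA : A ⊆ hyperplane n t) (hb : Bornology.IsBounded A) : surf d A < ⊤ := by
  have h1 : surf d A ≤ (surf d).restrict (hyperplane n t) (closure A) := by
    rw [Measure.restrict_apply isClosed_closure.measurableSet]
    exact measure_mono (subset_inter subset_closure hA)
  refine h1.trans_lt ?_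
  have hi := isometry_hyperplaneParam n t
  rw [surf_restrict_hyperplane hn, Measure.map_apply hi.continuous.measurable
    isClosed_closure.measurableSet]
  exact (hi.antilipschitz.isBounded_preimage hb.closure).measure_lt_top

lemma volume_hyperplane {v : Euc d} (hv : v ≠ 0) (t : ℝ) : volume (hyperplane v t) = 0 := by
  by_cases hx : ∃ x0, ⟪v, x0⟫ = t
  · obtain ⟨x0, hx0⟩ := hx
    have h1 := Measure.addHaar_affineSubspace (volume : Measure (Euc d))
      (AffineSubspace.mk' x0 (ℝ ∙ v)ᗮ) (by
        intro htop
        have hd := congrArg AffineSubspace.direction htop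
        rw [AffineSubspace.direction_mk', AffineSubspace.direction_top] at hd
        have : v ∈ (ℝ ∙ v)ᗮ := hd ▸ Submodule.mem_top
        rw [Submodule.mem_orthogonal_singleton_iff_inner_right] at this
        exact hv (inner_self_eq_zero.1 this))
    refine measure_mono_null (fun x hx => ?_) h1
    rw [SetLike.mem_coe, AffineSubspace.mem_mk', Submodule.mem_orthogonal_singleton_iff_inner_right,
      vsub_eq_sub, inner_sub_right, hx0, sub_eq_zero]
    exact hx
  · convert measure_empty (μ := (volume : Measure (Euc d)))
    exact eq_empty_iff_forall_notMem.2 fun x hx' => hx ⟨x, hx'⟩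

/-- Choose `e` parallel to the first hyperplane and transverse to the second. The first hyperplane
is invariant under translation along `e`, so in the Fubini decomposition all its slices are this
intersection; its volume is zero, so the slice is null. -/
lemma surf_hyperplane_inter {n m : Euc d} (hn : ‖n‖ = 1) (hm : ‖m‖ = 1) (h1 : m ≠ n) (h2 : m ≠ -n)
    (s t : ℝ) : surf d (hyperplane m s ∩ hyperplane n t) = 0 := by
  have hlt : |⟪n, m⟫| < 1 := by
    refine lt_of_le_of_ne (by simpa [hn, hm] using abs_real_inner_le_norm n m) fun h => ?_
    rcases (abs_eq zero_le_one).1 h with h | h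
    · exact h1 ((inner_eq_one_iff_of_norm_eq_one hn hm).1 h).symm
    · exact h2 (by
        have := (inner_eq_neg_one_iff_of_norm_eq_one hn hm).1 h
        rw [this, neg_neg])
  set e := n - ⟪n, m⟫ • m with he
  have hem : ⟪m, e⟫ = 0 := by
    simp [he, inner_sub_right, inner_smul_right, hm, real_inner_comm]
  have hen : ⟪n, e⟫ = 1 - ⟪n, m⟫ ^ 2 := by
    simp [he, inner_sub_right, inner_smul_right, hn]; ring
  have hen0 : ⟪n, e⟫ ≠ 0 := by
    rw [hen]; nlinarith [sq_abs ⟪n, m⟫, abs_nonneg ⟪n, m⟫]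
  have hmp := measurePreserving_hyperplane_add hn t hen0
  have := sfinite_surf_restrict hn t
  have hvol := volume_hyperplane (v := m) (by rintro rfl; simp at hm) s
  rw [← hmp.map_eq, Measure.map_apply hmp.measurable (isClosed_hyperplane m s).measurableSet,
    Measure.measure_prod_null (hmp.measurable (isClosed_hyperplane m s).measurableSet)] at hvol
  have hpos : (ENNReal.ofReal |⟪n, e⟫| • (volume : Measure ℝ)) ≠ 0 := by
    intro h
    have := congrArg (fun μ : Measure ℝ => μ univ) h
    simp [hen0] at this
  have : NeZero (ENNReal.ofReal |⟪n, e⟫| • (volume : Measure ℝ)) := ⟨hpos⟩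
  obtain ⟨x, hx⟩ := hvol.exists
  have hset : (Prod.mk x ⁻¹' ((fun p : ℝ × Euc d => p.2 + p.1 • e) ⁻¹' hyperplane m s))
      = hyperplane m s := by
    ext y
    simp [hyperplane, inner_add_right, inner_smul_right, hem]
  have hx : (surf d).restrict (hyperplane n t) (Prod.mk x ⁻¹' _) = 0 := hx
  rw [hset, Measure.restrict_apply (isClosed_hyperplane m s).measurableSet] at hx
  exact hx

/-! ### Integrating directional derivatives along rays -/

lemma integral_Iic_lineDeriv {φ : Euc d → ℝ} {K : ℝ≥0} (hφ : LipschitzWith K φ)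
    (hc : HasCompactSupport φ) {e : Euc d} (he : e ≠ 0) (p : Euc d) :
    ∫ s in Iic (0 : ℝ), lineDeriv ℝ φ (p + s • e) e = φ p := by
  set ψ : ℝ → ℝ := fun s => φ (p + s • e) with hψ
  have hder : ∀ s : ℝ, lineDeriv ℝ φ (p + s • e) e = deriv ψ s := fun s => by
    have h1 := deriv_comp_const_add (f := ψ) s 0
    rw [add_zero] at h1
    rw [← h1, lineDeriv]
    congr 1
    ext t
    simp only [hψ, add_smul, add_assoc]
  have hψL : LipschitzWith (K * ‖e‖₊) ψ := by
    refine LipschitzWith.of_dist_le_mul fun a b => ?_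
    refine (hφ.dist_le_mul _ _).trans (le_of_eq ?_)
    rw [dist_add_left, dist_eq_norm, ← sub_smul, norm_smul, Real.dist_eq, Real.norm_eq_abs]
    push_cast
    ring
  obtain ⟨r, hr⟩ := hc.isCompact.isBounded.subset_closedBall 0
  have hepos : 0 < ‖e‖ := norm_pos_iff.2 he
  set R : ℝ := (|r| + ‖p‖) / ‖e‖ with hR
  have hR0 : 0 ≤ R := by positivity
  have hzero : ∀ s < -R, ψ s = 0 := fun s hs => by
    by_contra hne
    have h1 : p + s • e ∈ Metric.closedBall (0 : Euc d) r := hr (subset_tsupport _ hne)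
    rw [mem_closedBall_zero_iff] at h1
    have h2 : ‖s • e‖ ≤ ‖p + s • e‖ + ‖p‖ := by
      simpa using norm_sub_le (p + s • e) p
    rw [norm_smul, Real.norm_eq_abs] at h2
    have h3 : |s| ≤ R := by
      rw [hR, le_div_iff₀ hepos]
      linarith [le_abs_self r]
    have := neg_abs_le s
    linarith
  have hdzero : ∀ s < -R, deriv ψ s = 0 := fun s hs => by
    have : ψ =ᶠ[𝓝 s] fun _ => 0 := by
      filter_upwards [Iio_mem_nhds hs] with y hy using hzero y hy
    rw [this.deriv_eq, deriv_const]
  simp_rw [hder]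
  -- The cut is at `-(R + 1)` and not at `-R` because `ψ` is only known to vanish strictly to the
  -- left of `-R`.
  have hsub : ∫ s in Iic (0 : ℝ), deriv ψ s = ∫ s in Ioc (-(R + 1)) 0, deriv ψ s :=
    setIntegral_eq_of_subset_of_forall_sdiff_eq_zero measurableSet_Iic
      (fun s hs => hs.2) (fun s hs => hdzero s (by
        have h1 : s ≤ 0 := hs.1
        have h2 : ¬ (-(R + 1) < s) := fun h => hs.2 ⟨h, h1⟩
        linarith))
  rw [hsub, ← intervalIntegral.integral_of_le (by linarith),
    (hψL.lipschitzOnWith.absolutelyContinuousOnInterval).integral_deriv_eq_sub,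
    hzero (-(R + 1)) (by linarith)]
  simp [hψ]

lemma integrable_lineDeriv {φ : Euc d → ℝ} {K : ℝ≥0} (hφ : LipschitzWith K φ)
    (hc : HasCompactSupport φ) (e : Euc d) : Integrable (fun x => lineDeriv ℝ φ x e) := by
  have hsupp : Function.support (fun x => lineDeriv ℝ φ x e) ⊆ tsupport φ := by
    intro x hx
    by_contra hxs
    have h1 : φ =ᶠ[𝓝 x] 0 := notMem_tsupport_iff_eventuallyEq.1 hxs
    refine hx ?_
    change lineDeriv ℝ φ x e = 0
    rw [h1.lineDeriv_eq]
    simp [lineDeriv]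
  rw [← integrableOn_iff_integrable_of_support_subset hsupp]
  have : IsFiniteMeasure (volume.restrict (tsupport φ)) :=
    ⟨by simpa using hc.isCompact.measure_lt_top⟩
  exact ((hφ.memLp_lineDeriv (μ := volume) e).restrict _).integrable le_top

/-- The set of points from which the ray in direction `e` meets the subset `A` of a hyperplane. -/
def shadow (n : Euc d) (t : ℝ) (e : Euc d) (A : Set (Euc d)) : Set (Euc d) :=
  {x | 0 ≤ (t - ⟪n, x⟫) / ⟪n, e⟫ ∧ x + ((t - ⟪n, x⟫) / ⟪n, e⟫) • e ∈ A}

lemma measurableSet_shadow (n : Euc d) (t : ℝ) (e : Euc d) {A : Set (Euc d)}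
    (hA : MeasurableSet A) : MeasurableSet (shadow n t e A) := by
  refine MeasurableSet.inter ?_ ?_
  · have : Continuous fun x : Euc d => (t - ⟪n, x⟫) / ⟪n, e⟫ := by fun_prop
    exact this.measurable measurableSet_Ici
  · have : Continuous fun x : Euc d => x + ((t - ⟪n, x⟫) / ⟪n, e⟫) • e := by fun_prop
    exact this.measurable hA

/-- Fubini along `e`: the line through a point `p` of `A` lies in the shadow exactly for parameters
`s ≤ 0`, so the inner integral is `φ p` by the fundamental theorem of calculus, and other lines
contribute nothing. -/
lemma integral_shadow {n : Euc d} (hn : ‖n‖ = 1) {t : ℝ} {e : Euc d} (he : ⟪n, e⟫ ≠ 0)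
    {A : Set (Euc d)} (hA : MeasurableSet A) (hAH : A ⊆ hyperplane n t) {φ : Euc d → ℝ} {K : ℝ≥0}
    (hφ : LipschitzWith K φ) (hc : HasCompactSupport φ) :
    ∫ x in shadow n t e A, lineDeriv ℝ φ x e = |⟪n, e⟫| * ∫ x in A, φ x ∂surf d := by
  have hmp := measurePreserving_hyperplane_add hn t he
  have := sfinite_surf_restrict hn t
  have he0 : e ≠ 0 := by rintro rfl; simp at he
  have hS := measurableSet_shadow n t e hA
  set f : Euc d → ℝ := (shadow n t e A).indicator fun x => lineDeriv ℝ φ x e with hf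
  have hfi : Integrable f := (integrable_lineDeriv hφ hc e).indicator hS
  have hfm : AEStronglyMeasurable f (Measure.map (fun p : ℝ × Euc d => p.2 + p.1 • e)
      ((ENNReal.ofReal |⟪n, e⟫| • volume).prod ((surf d).restrict (hyperplane n t)))) := by
    rw [hmp.map_eq]; exact hfi.aestronglyMeasurable
  have hfi' : Integrable (fun p : ℝ × Euc d => f (p.2 + p.1 • e))
      ((ENNReal.ofReal |⟪n, e⟫| • volume).prod ((surf d).restrict (hyperplane n t))) :=
    hmp.integrable_comp_of_integrable hfi
  rw [← integral_indicator hS, ← hf, ← hmp.map_eq,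
    integral_map hmp.measurable.aemeasurable hfm, integral_prod_symm _ hfi']
  have hinner : ∀ p ∈ hyperplane n t,
      ∫ s, f (p + s • e) ∂(ENNReal.ofReal |⟪n, e⟫| • volume) =
        A.indicator (fun p => |⟪n, e⟫| * φ p) p := fun p hp => by
    rw [integral_smul_measure, ENNReal.toReal_ofReal (abs_nonneg _), smul_eq_mul]
    have hp : ⟪n, p⟫ = t := hp
    have hpar : ∀ s : ℝ, (t - ⟪n, p + s • e⟫) / ⟪n, e⟫ = -s := fun s => by
      rw [inner_add_right, inner_smul_right, hp]
      field_simp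
      ring
    have hmem : ∀ s : ℝ, p + s • e ∈ shadow n t e A ↔ s ≤ 0 ∧ p ∈ A := fun s => by
      simp only [shadow, mem_ofPred_eq, hpar]
      rw [neg_smul, add_neg_cancel_right, neg_nonneg]
    by_cases hpA : p ∈ A
    · rw [indicator_of_mem hpA, ← integral_Iic_lineDeriv hφ hc he0 p,
        ← integral_indicator measurableSet_Iic]
      congr 2
      ext s
      by_cases hs : s ≤ 0
      · rw [hf, indicator_of_mem ((hmem s).2 ⟨hs, hpA⟩), indicator_of_mem (mem_Iic.2 hs)]
      · rw [hf, indicator_of_notMem (fun h => hs ((hmem s).1 h).1),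
          indicator_of_notMem (s := Iic (0 : ℝ)) hs]
    · rw [indicator_of_notMem hpA]
      have : ∀ s : ℝ, f (p + s • e) = 0 := fun s =>
        indicator_of_notMem (fun h => hpA ((hmem s).1 h).2) _
      simp [this]
  rw [setIntegral_congr_fun (isClosed_hyperplane n t).measurableSet hinner,
    integral_indicator hA, Measure.restrict_restrict hA, inter_eq_left.2 hAH, integral_const_mul]

/-- A Lipschitz extension is clipped between `-η` and `η`, where `η` is a tent equal to a bound `B`
of `|f|` on `C` and zero at distance at least 1. -/
lemma exists_lipschitz_hasCompactSupport_extension {C : Set (Euc d)}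
    (hb : Bornology.IsBounded C) (hne : C.Nonempty) {f : Euc d → ℝ} {K : ℝ≥0}
    (hf : LipschitzOnWith K f C) :
    ∃ (g : Euc d → ℝ) (K' : ℝ≥0), LipschitzWith K' g ∧ HasCompactSupport g ∧ EqOn f g C := by
  obtain ⟨g₀, hg₀, hfg⟩ := hf.extend_real
  obtain ⟨x0, hx0⟩ := hne
  obtain ⟨B, hB⟩ : ∃ B : ℝ, ∀ x ∈ C, |f x| ≤ B := by
    refine ⟨|f x0| + K * Metric.diam C, fun x hx => ?_⟩
    have h1 := hf.dist_le_mul x hx x0 hx0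
    have h2 := Metric.dist_le_diam_of_mem hb hx hx0
    have h3 : |f x| ≤ |f x0| + |f x - f x0| := by
      have := abs_add_le (f x0) (f x - f x0); simpa using this
    rw [Real.dist_eq] at h1
    have : (K : ℝ) * dist x x0 ≤ K * Metric.diam C := by gcongr
    linarith
  have hB0 : 0 ≤ B := (abs_nonneg _).trans (hB x0 hx0)
  set η : Euc d → ℝ := fun x => max (B - B * Metric.infDist x C) 0 with hη
  have hηL : LipschitzWith B.toNNReal η := by
    have h1 : LipschitzWith B.toNNReal fun x : Euc d => B - B * Metric.infDist x C := by
      refine LipschitzWith.of_dist_le_mul fun x y => ?_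
      have := (Metric.lipschitz_infDist_pt C).dist_le_mul x y
      rw [Real.dist_eq] at this ⊢
      rw [show B - B * Metric.infDist x C - (B - B * Metric.infDist y C) =
        -(B * (Metric.infDist x C - Metric.infDist y C)) by ring, abs_neg, abs_mul,
        abs_of_nonneg hB0, Real.coe_toNNReal _ hB0]
      gcongr
      simpa using this
    exact h1.max_const 0
  refine ⟨fun x => min (max (g₀ x) (-η x)) (η x), _, (hg₀.max hηL.neg).min hηL, ?_, fun x hx => ?_⟩
  · refine HasCompactSupport.intro (K := Metric.cthickening 2 C)
      (Metric.isCompact_of_isClosed_isBounded Metric.isClosed_cthickening hb.cthickening)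
      fun x hx => ?_
    have h1 : 1 < Metric.infDist x C := by
      by_contra hle
      obtain ⟨y, hy, hxy⟩ := (Metric.infDist_lt_iff ⟨x0, hx0⟩).1
        (lt_of_le_of_lt (not_lt.1 hle) one_lt_two)
      exact hx (Metric.mem_cthickening_of_dist_le x y 2 C hy hxy.le)
    have h2 : η x = 0 := max_eq_right (by nlinarith)
    simp [h2]
  · have h1 : η x = B := by simp [hη, Metric.infDist_zero_of_mem hx, hB0]
    have h2 := abs_le.1 (hB x hx)
    simp only [h1, ← hfg hx]
    rw [max_eq_left h2.1, min_eq_left h2.2]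

/-! ### Convex polytopes and the divergence theorem -/

/-- `C` is a convex body cut out by finitely many half-spaces with outer unit normals in `S`, where
the half-space with normal `n` has level `c n`. -/
structure IsPolytopeWith (C : Set (Euc d)) (S : Finset (Euc d)) (c : Euc d → ℝ) : Prop where
  bounded : Bornology.IsBounded C
  interior_nonempty : (interior C).Nonempty
  unit : ∀ n ∈ S, ‖n‖ = 1
  mem_iff : ∀ x, x ∈ C ↔ ∀ n ∈ S, ⟪n, x⟫ ≤ c n

/-- Taking the support function as the level makes the level depend on the normal alone, so that no
two parallel constraints with the same outer normal survive. -/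
lemma IsConvexBodyPolytope.exists_isPolytopeWith {C : Set (Euc d)} (hC : IsConvexBodyPolytope C) :
    ∃ S c, IsPolytopeWith C S c := by
  classical
  obtain ⟨hb, hi, m, a, b, hab⟩ := hC
  obtain ⟨R, hR⟩ := hb.exists_norm_le
  set c : Euc d → ℝ := fun n => sSup ((fun x => ⟪n, x⟫) '' C) with hc
  have hle : ∀ n : Euc d, ∀ x ∈ C, ⟪n, x⟫ ≤ c n := fun n x hx => by
    refine le_csSup ⟨‖n‖ * R, ?_⟩ ⟨x, hx, rfl⟩
    rintro _ ⟨y, hy, rfl⟩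
    refine (real_inner_le_norm n y).trans ?_
    gcongr
    exact hR y hy
  have hmem : ∀ x, x ∈ C ↔ ∀ k, ⟪a k, x⟫ ≤ b k := fun x => by rw [hab]; rfl
  obtain ⟨x0, hx0⟩ := id hi
  have hx0 := interior_subset hx0
  refine ⟨(Finset.univ.filter fun k => a k ≠ 0).image fun k => ‖a k‖⁻¹ • a k, c, hb, hi, ?_, ?_⟩
  · intro n hn
    obtain ⟨k, hk, rfl⟩ := Finset.mem_image.1 hn
    exact norm_smul_inv_norm (𝕜 := ℝ) (Finset.mem_filter.1 hk).2
  · refine fun x => ⟨fun hx n _ => hle n x hx, fun hx => (hmem x).2 fun k => ?_⟩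
    by_cases hk : a k = 0
    · have := (hmem x0).1 hx0 k
      simpa [hk] using this
    · have hpos : 0 < ‖a k‖ := norm_pos_iff.2 hk
      have h1 := hx _ (Finset.mem_image_of_mem _ (Finset.mem_filter.2 ⟨Finset.mem_univ k, hk⟩))
      have h2 : c (‖a k‖⁻¹ • a k) ≤ ‖a k‖⁻¹ * b k := by
        refine csSup_le ⟨_, x0, hx0, rfl⟩ ?_
        rintro _ ⟨y, hy, rfl⟩
        simp only [real_inner_smul_left]
        gcongr
        exact (hmem y).1 hy k
      rw [real_inner_smul_left] at h1
      exact le_of_mul_le_mul_left (h1.trans h2) (inv_pos.2 hpos)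

/-- A line crosses the boundary of a polytope once upwards and once downwards, or misses it. -/
lemma ite_mem_eq_sum_crossings {ι : Type*} (S : Finset ι) (k r : ι → ℝ)
    (hpos : ∃ n ∈ S, 0 < k n) (hneg : ∃ n ∈ S, k n < 0)
    (hinj : ∀ n ∈ S, ∀ m ∈ S, n ≠ m → k n ≠ 0 → k m ≠ 0 → r n / k n ≠ r m / k m)
    (h0 : ∀ n ∈ S, k n ≠ 0 → r n / k n ≠ 0) [Decidable (∀ n ∈ S, 0 ≤ r n)]
    [∀ n, Decidable (0 ≤ r n / k n ∧ ∀ m ∈ S, r n / k n * k m ≤ r m)] :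
    (if ∀ n ∈ S, 0 ≤ r n then (1 : ℝ) else 0) =
      ∑ n ∈ S, if 0 ≤ r n / k n ∧ ∀ m ∈ S, r n / k n * k m ≤ r m then k n / |k n| else 0 := by
  classical
  obtain ⟨b, hbP, hb⟩ := (S.filter fun n => 0 < k n).exists_min_image (fun n => r n / k n)
    (by obtain ⟨n, hn, h⟩ := hpos; exact ⟨n, Finset.mem_filter.2 ⟨hn, h⟩⟩)
  obtain ⟨a, haQ, ha⟩ := (S.filter fun n => k n < 0).exists_max_image (fun n => r n / k n)
    (by obtain ⟨n, hn, h⟩ := hneg; exact ⟨n, Finset.mem_filter.2 ⟨hn, h⟩⟩)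
  simp only [Finset.mem_filter] at hbP haQ hb ha
  -- The line is inside exactly between its last entry, at `a`, and its first exit, at `b`, provided
  -- that the constraints parallel to it hold.
  have hIn : ∀ t : ℝ, (∀ m ∈ S, t * k m ≤ r m) ↔
      (∀ m ∈ S, k m = 0 → 0 ≤ r m) ∧ r a / k a ≤ t ∧ t ≤ r b / k b := fun t => by
    constructor
    · refine fun h => ⟨fun m hm h0 => by simpa [h0] using h m hm, ?_, ?_⟩
      · exact (div_le_iff_of_neg haQ.2).2 (h a haQ.1)
      · exact (le_div_iff₀ hbP.2).2 (h b hbP.1)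
    · rintro ⟨hz, h1, h2⟩ m hm
      rcases lt_trichotomy (k m) 0 with h | h | h
      · exact (div_le_iff_of_neg h).1 ((ha m ⟨hm, h⟩).trans h1)
      · simpa [h] using hz m hm h
      · exact (le_div_iff₀ h).1 (h2.trans (hb m ⟨hm, h⟩))
  have hIn0 : (∀ m ∈ S, 0 ≤ r m) ↔
      (∀ m ∈ S, k m = 0 → 0 ≤ r m) ∧ r a / k a ≤ 0 ∧ 0 ≤ r b / k b := by simpa using hIn 0
  have hab : a ≠ b := by rintro rfl; linarith [haQ.2, hbP.2]
  -- Entry and exit are the only crossings that lie on the polytope, since `hinj` rules out ties.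
  -- Their signs are -1 and +1: both count or neither does if they are on the same side of 0, and
  -- only the exit counts if 0 lies between.
  rw [Finset.sum_eq_add_of_mem a b haQ.1 hbP.1 hab]
  · have hsa : k a / |k a| = -1 := by
      rw [abs_of_neg haQ.2, div_neg, div_self haQ.2.ne]
    have hsb : k b / |k b| = 1 := by
      rw [abs_of_pos hbP.2, div_self hbP.2.ne']
    have ha0 := h0 a haQ.1 haQ.2.ne
    simp only [hIn, hIn0, hsa, hsb, le_refl, true_and, and_true]
    by_cases hz : ∀ m ∈ S, k m = 0 → 0 ≤ r m
    · simp only [eq_true hz, true_and]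
      rcases lt_or_gt_of_ne ha0 with h | h
      · by_cases h2 : 0 ≤ r b / k b
        · simp [h2, h.le, not_le.2 h, h.le.trans h2]
        · simp [h2, not_le.2 h]
      · by_cases h2 : r a / k a ≤ r b / k b
        · simp [h2, h.le, h.le.trans h2, not_le.2 h]
        · simp [h2, not_le.2 h]
    · simp only [eq_false hz, false_and, and_false, if_false, add_zero]
  · intro n hn hne
    split_ifs with h
    · obtain ⟨-, h1, h2⟩ := (hIn _).1 h.2
      rcases lt_trichotomy (k n) 0 with hk | hk | hk
      · exact absurd (le_antisymm (ha n ⟨hn, hk⟩) h1) (hinj n hn a haQ.1 hne.1 hk.ne haQ.2.ne)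
      · simp [hk]
      · exact absurd (le_antisymm h2 (hb n ⟨hn, hk⟩)) (hinj n hn b hbP.1 hne.2 hk.ne' hbP.2.ne')
    · rfl

namespace IsPolytopeWith

variable {C : Set (Euc d)} {S : Finset (Euc d)} {c : Euc d → ℝ}

lemma isClosed (h : IsPolytopeWith C S c) : IsClosed C := by
  have : C = ⋂ n ∈ S, {x | ⟪n, x⟫ ≤ c n} := by
    ext x; simp [h.mem_iff]
  rw [this]
  exact isClosed_biInter fun n _ => isClosed_le (by fun_prop) continuous_const

lemma isCompact (h : IsPolytopeWith C S c) : IsCompact C :=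
  Metric.isCompact_of_isClosed_isBounded h.isClosed h.bounded

lemma convex (h : IsPolytopeWith C S c) : Convex ℝ C := by
  intro x hx y hy a b ha hb hab
  refine (h.mem_iff _).2 fun n hn => ?_
  rw [inner_add_right, inner_smul_right, inner_smul_right]
  have h1 := mul_le_mul_of_nonneg_left ((h.mem_iff x).1 hx n hn) ha
  have h2 := mul_le_mul_of_nonneg_left ((h.mem_iff y).1 hy n hn) hb
  have h3 : a * c n + b * c n = c n := by rw [← add_mul, hab, one_mul]
  linarith

lemma nonempty (h : IsPolytopeWith C S c) : C.Nonempty := h.interior_nonempty.mono interior_subset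

/-- A convex body lies in no slab of width zero. -/
lemma neg_level_lt (h : IsPolytopeWith C S c) {n : Euc d} (hn : ‖n‖ = 1) {s t : ℝ}
    (hs : ∀ x ∈ C, ⟪n, x⟫ ≤ s) (ht : ∀ x ∈ C, t ≤ ⟪n, x⟫) : t < s := by
  obtain ⟨x, hx⟩ := h.interior_nonempty
  obtain ⟨ε, hε, hball⟩ := Metric.isOpen_iff.1 isOpen_interior x hx
  have h1 : x + (ε / 2) • n ∈ C := interior_subset (hball (by
    rw [Metric.mem_ball, dist_self_add_left, norm_smul, hn, Real.norm_of_nonneg (by positivity)]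
    linarith))
  have h2 := hs _ h1
  have h3 := ht _ (interior_subset hx)
  rw [inner_add_right, inner_smul_right, real_inner_self_eq_norm_sq, hn] at h2
  linarith

/-- Otherwise `C` would contain a ray in direction `e`, against boundedness. -/
lemma exists_inner_pos (h : IsPolytopeWith C S c) {e : Euc d} (he : e ≠ 0) :
    ∃ n ∈ S, 0 < ⟪n, e⟫ := by
  by_contra! hcon
  obtain ⟨x, hx⟩ := h.nonempty
  obtain ⟨R, hR⟩ := h.bounded.exists_norm_le
  have hepos := norm_pos_iff.2 he
  have h0 := (norm_nonneg _).trans (hR x hx)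
  have h1 : ∀ s : ℝ, 0 ≤ s → x + s • e ∈ C := fun s hs => (h.mem_iff _).2 fun n hn => by
    rw [inner_add_right, inner_smul_right]
    nlinarith [(h.mem_iff x).1 hx n hn, hcon n hn]
  have h2 := hR _ (h1 ((2 * R + 1) / ‖e‖) (by positivity))
  have h3 := norm_sub_le (x + ((2 * R + 1) / ‖e‖) • e) x
  rw [add_sub_cancel_left, norm_smul, Real.norm_of_nonneg (by positivity),
    div_mul_cancel₀ _ hepos.ne'] at h3
  linarith [hR x hx]

/-- Each coincidence confines `x` to a hyperplane, unless the linear forms are proportional. In that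
case the normals are opposite, and a coincidence would put `C` in a slab of width zero. -/
lemma ae_generic_direction (h : IsPolytopeWith C S c) (e : Euc d) :
    ∀ᵐ x : Euc d, (∀ n ∈ S, ∀ m ∈ S, n ≠ m → ⟪n, e⟫ ≠ 0 → ⟪m, e⟫ ≠ 0 →
      (c n - ⟪n, x⟫) / ⟪n, e⟫ ≠ (c m - ⟪m, x⟫) / ⟪m, e⟫) ∧
      ∀ n ∈ S, ⟪n, e⟫ ≠ 0 → (c n - ⟪n, x⟫) / ⟪n, e⟫ ≠ 0 := by
  have hnull : ∀ (v : Euc d) (t : ℝ), v ≠ 0 → ∀ᵐ x : Euc d, ⟪v, x⟫ ≠ t := fun v t hv =>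
    measure_eq_zero_iff_ae_notMem.1 (volume_hyperplane hv t)
  have h1 : ∀ᵐ x : Euc d, ∀ n ∈ S, ∀ m ∈ S, n ≠ m → ⟪n, e⟫ ≠ 0 → ⟪m, e⟫ ≠ 0 →
      (c n - ⟪n, x⟫) / ⟪n, e⟫ ≠ (c m - ⟪m, x⟫) / ⟪m, e⟫ := by
    refine (ae_ball_iff S.countable_toSet).2 fun n hn => ?_
    refine (ae_ball_iff S.countable_toSet).2 fun m hm => ?_
    by_cases hcond : n ≠ m ∧ ⟪n, e⟫ ≠ 0 ∧ ⟪m, e⟫ ≠ 0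
    swap
    · exact ae_of_all _ fun x h1 h2 h3 => absurd ⟨h1, h2, h3⟩ hcond
    obtain ⟨hnm, hne, hme⟩ := hcond
    by_cases hv : ⟪n, e⟫ • m - ⟪m, e⟫ • n = 0
    · refine ae_of_all _ fun x _ _ _ hx => ?_
      have hneg : m = -n := by
        have h2 := congrArg norm (sub_eq_zero.1 hv)
        rw [norm_smul, norm_smul, h.unit n hn, h.unit m hm, mul_one, mul_one,
          Real.norm_eq_abs, Real.norm_eq_abs] at h2
        rcases abs_eq_abs.1 h2 with h3 | h3
        · rw [h3, ← smul_sub] at hv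
          exact absurd (sub_eq_zero.1 ((smul_eq_zero.1 hv).resolve_left hme)).symm hnm
        · rw [h3, neg_smul, ← neg_add', neg_eq_zero, ← smul_add] at hv
          exact eq_neg_of_add_eq_zero_left ((smul_eq_zero.1 hv).resolve_left hme)
      subst hneg
      rw [inner_neg_left, inner_neg_left] at hx
      field_simp at hx
      have h3 := h.neg_level_lt (h.unit n hn) (s := c n) (t := -c (-n))
        (fun y hy => (h.mem_iff y).1 hy n hn)
        (fun y hy => by
          have := (h.mem_iff y).1 hy (-n) hm
          rw [inner_neg_left] at this
          linarith)
      linarith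
    · filter_upwards [hnull _ (⟪n, e⟫ * c m - ⟪m, e⟫ * c n) hv] with x hx _ _ _ heq
      refine hx ?_
      rw [div_eq_div_iff hne hme] at heq
      rw [inner_sub_left, real_inner_smul_left, real_inner_smul_left]
      linarith
  have h2 : ∀ᵐ x : Euc d, ∀ n ∈ S, ⟪n, e⟫ ≠ 0 → (c n - ⟪n, x⟫) / ⟪n, e⟫ ≠ 0 := by
    refine (ae_ball_iff S.countable_toSet).2 fun n hn => ?_
    have hn0 : n ≠ 0 := by
      rintro rfl
      simpa using h.unit 0 hn
    filter_upwards [hnull n (c n) hn0] with x hx hne heq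
    rcases div_eq_zero_iff.1 heq with h3 | h3
    · exact hx (by linarith)
    · exact hne h3
  exact h1.and h2

/-- For almost every `x`, the indicator of `C` is the sum of the indicators of the shadows of the
facets, signed by `⟪n, e⟫`. Integrating, the sign times the Jacobian `|⟪n, e⟫|` gives back `⟪n, e⟫`.
-/
lemma integral_lineDeriv (h : IsPolytopeWith C S c) {φ : Euc d → ℝ} {K : ℝ≥0}
    (hφ : LipschitzWith K φ) (hc : HasCompactSupport φ) {e : Euc d} (he : e ≠ 0) :
    ∫ x in C, lineDeriv ℝ φ x e =
      ∑ n ∈ S, ⟪n, e⟫ * ∫ x in C ∩ hyperplane n (c n), φ x ∂surf d := by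
  classical
  have hCm := h.isClosed.measurableSet
  have hFm : ∀ n, MeasurableSet (C ∩ hyperplane n (c n)) := fun n =>
    hCm.inter (isClosed_hyperplane n _).measurableSet
  have hint := integrable_lineDeriv hφ hc e
  have hae : ∀ᵐ x : Euc d, C.indicator (fun x => lineDeriv ℝ φ x e) x =
      ∑ n ∈ S, ⟪n, e⟫ / |⟪n, e⟫| *
        (shadow n (c n) e (C ∩ hyperplane n (c n))).indicator (fun x => lineDeriv ℝ φ x e) x := by
    filter_upwards [h.ae_generic_direction e] with x hx
    have hneg : ∃ n ∈ S, ⟪n, e⟫ < 0 := by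
      obtain ⟨n, hn, h1⟩ := h.exists_inner_pos (neg_ne_zero.2 he)
      exact ⟨n, hn, by rwa [inner_neg_right, neg_pos] at h1⟩
    have key := ite_mem_eq_sum_crossings S (fun n => ⟪n, e⟫) (fun n => c n - ⟪n, x⟫)
      (h.exists_inner_pos he) hneg hx.1 hx.2
    have h1 : C.indicator (fun x => lineDeriv ℝ φ x e) x =
        (if ∀ n ∈ S, 0 ≤ c n - ⟪n, x⟫ then (1 : ℝ) else 0) * lineDeriv ℝ φ x e := by
      simp only [indicator_apply, h.mem_iff, sub_nonneg, ite_mul, one_mul, zero_mul]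
    rw [h1, key, Finset.sum_mul]
    refine Finset.sum_congr rfl fun n hn => ?_
    by_cases hk : ⟪n, e⟫ = 0
    · simp [hk]
    have hmem : x ∈ shadow n (c n) e (C ∩ hyperplane n (c n)) ↔
        0 ≤ (c n - ⟪n, x⟫) / ⟪n, e⟫ ∧
          ∀ m ∈ S, (c n - ⟪n, x⟫) / ⟪n, e⟫ * ⟪m, e⟫ ≤ c m - ⟪m, x⟫ := by
      have h2 : x + ((c n - ⟪n, x⟫) / ⟪n, e⟫) • e ∈ hyperplane n (c n) := by
        change ⟪n, x + ((c n - ⟪n, x⟫) / ⟪n, e⟫) • e⟫ = c n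
        rw [inner_add_right, inner_smul_right, div_mul_cancel₀ _ hk]
        ring
      simp only [shadow, mem_ofPred_eq, mem_inter_iff, h2, and_true, h.mem_iff, inner_add_right,
        inner_smul_right, le_sub_iff_add_le']
    rw [indicator_apply]
    simp only [hmem, ite_mul, mul_ite, zero_mul, mul_zero]
  rw [← integral_indicator hCm, integral_congr_ae hae, integral_finsetSum]
  · refine Finset.sum_congr rfl fun n hn => ?_
    rw [integral_const_mul, integral_indicator (measurableSet_shadow _ _ _ (hFm n))]
    by_cases hk : ⟪n, e⟫ = 0
    · simp [hk]
    rw [integral_shadow (h.unit n hn) hk (hFm n) inter_subset_right hφ hc, ← mul_assoc,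
      div_mul_cancel₀ _ (abs_ne_zero.2 hk)]
  · exact fun n _ => (hint.indicator (measurableSet_shadow _ _ _ (hFm n))).const_mul _

end IsPolytopeWith

lemma integrableOn_of_continuousOn_of_isCompact {X F : Type*} [TopologicalSpace X]
    [MeasurableSpace X] [BorelSpace X] [T2Space X] [SecondCountableTopology X]
    [NormedAddCommGroup F] {μ : Measure X} {A : Set X} (hA : IsCompact A) (hμ : μ A ≠ ⊤)
    {f : X → F} (hf : ContinuousOn f A) : IntegrableOn f A μ := by
  obtain ⟨B, hB⟩ := hA.exists_bound_of_continuousOn hf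
  have : IsFiniteMeasure (μ.restrict A) := ⟨by simpa using hμ.lt_top⟩
  exact Integrable.of_bound (hf.aestronglyMeasurable_of_isCompact hA hA.measurableSet) B
    ((ae_restrict_iff' hA.measurableSet).2 (ae_of_all _ hB))

lemma divergence_eq_sum (w : Euc d → Euc d) (x : Euc d) :
    divergence w x = ∑ k, fderiv ℝ w x (EuclideanSpace.single k 1) k := by
  rw [divergence, LinearMap.trace_eq_sum_inner _ (EuclideanSpace.basisFun (Fin d) ℝ)]
  simp [EuclideanSpace.inner_single_left]

namespace IsPolytopeWith

variable {C : Set (Euc d)} {S : Finset (Euc d)} {c : Euc d → ℝ}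

lemma volume_frontier (h : IsPolytopeWith C S c) : volume (frontier C) = 0 :=
  h.convex.addHaar_frontier volume

lemma ae_mem_interior (h : IsPolytopeWith C S c) : ∀ᵐ x ∂volume.restrict C, x ∈ interior C := by
  rw [ae_restrict_iff' h.isClosed.measurableSet]
  filter_upwards [measure_eq_zero_iff_ae_notMem.1 h.volume_frontier] with x hx hxC
  by_contra hxi
  exact hx ⟨subset_closure hxC, hxi⟩

lemma ae_differentiableAt (h : IsPolytopeWith C S c) {w : Euc d → Euc d} {K : ℝ≥0}
    (hw : LipschitzOnWith K w C) :
    ∀ᵐ x ∂volume.restrict C, x ∈ interior C ∧ DifferentiableAt ℝ w x := by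
  have h1 := (ae_restrict_iff' h.isClosed.measurableSet).2 (hw.ae_differentiableWithinAt_of_mem
    (μ := volume))
  filter_upwards [h1, h.ae_mem_interior] with x hx hxi
  exact ⟨hxi, hx.differentiableAt (mem_interior_iff_mem_nhds.1 hxi)⟩

lemma isCompact_facet (h : IsPolytopeWith C S c) (n : Euc d) (t : ℝ) :
    IsCompact (C ∩ hyperplane n t) := h.isCompact.inter_right (isClosed_hyperplane n t)

lemma surf_facet_lt_top (h : IsPolytopeWith C S c) {n : Euc d} (hn : ‖n‖ = 1) (t : ℝ) :
    surf d (C ∩ hyperplane n t) < ⊤ :=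
  surf_lt_top_of_isBounded hn inter_subset_right (h.bounded.subset inter_subset_left)

lemma integrableOn_facet (h : IsPolytopeWith C S c) {n : Euc d} (hn : ‖n‖ = 1) (t : ℝ)
    {f : Euc d → ℝ} (hf : ContinuousOn f C) : IntegrableOn f (C ∩ hyperplane n t) (surf d) :=
  integrableOn_of_continuousOn_of_isCompact (h.isCompact_facet n t) (h.surf_facet_lt_top hn t).ne
    (hf.mono inter_subset_left)

/-- The divergence theorem for Lipschitz vector fields on convex polytopes. -/
theorem integral_divergence (h : IsPolytopeWith C S c) {w : Euc d → Euc d} {K : ℝ≥0}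
    (hw : LipschitzOnWith K w C) :
    ∫ x in C, divergence w x = ∑ n ∈ S, ∫ x in C ∩ hyperplane n (c n), ⟪w x, n⟫ ∂surf d := by
  have hcoord : ∀ k : Fin d, LipschitzOnWith K (fun x => w x k) C := fun k =>
    LipschitzOnWith.of_dist_le_mul fun x hx y hy => by
      refine le_trans ?_ (hw.dist_le_mul x hx y hy)
      rw [dist_eq_norm, dist_eq_norm]
      exact PiLp.norm_apply_le (w x - w y) k
  -- Each coordinate of `w` is extended separately; interior points see the same derivative, and the
  -- frontier of `C` is null.
  choose g K' hgL hgc hgw using fun k =>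
    exists_lipschitz_hasCompactSupport_extension h.bounded h.nonempty (hcoord k)
  have hae : ∀ᵐ x ∂volume.restrict C, divergence w x =
      ∑ k, lineDeriv ℝ (g k) x (EuclideanSpace.single k 1) := by
    filter_upwards [h.ae_differentiableAt hw] with x hx
    rw [divergence_eq_sum]
    refine Finset.sum_congr rfl fun k _ => ?_
    have h1 : g k =ᶠ[𝓝 x] fun y => w y k := by
      filter_upwards [mem_interior_iff_mem_nhds.1 hx.1] with y hy using (hgw k hy).symm
    have h2 : HasFDerivAt (fun y => w y k) ((EuclideanSpace.proj k).comp (fderiv ℝ w x)) x :=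
      (EuclideanSpace.proj (𝕜 := ℝ) k).hasFDerivAt.comp x hx.2.hasFDerivAt
    rw [h1.lineDeriv_eq, (h2.hasLineDerivAt _).lineDeriv]
    simp
  rw [integral_congr_ae hae, integral_finsetSum _ fun k _ =>
    (integrable_lineDeriv (hgL k) (hgc k) _).integrableOn]
  have h1 : ∀ k : Fin d, ∫ x in C, lineDeriv ℝ (g k) x (EuclideanSpace.single k 1) =
      ∑ n ∈ S, ∫ x in C ∩ hyperplane n (c n), n k * w x k ∂surf d := fun k => by
    rw [h.integral_lineDeriv (hgL k) (hgc k) (by simp)]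
    refine Finset.sum_congr rfl fun n _ => ?_
    rw [integral_const_mul, EuclideanSpace.inner_single_right]
    congr 1
    · simp
    · exact setIntegral_congr_fun (h.isCompact_facet n _).measurableSet
        fun x hx => (hgw k hx.1).symm
  rw [Finset.sum_congr rfl fun k _ => h1 k, Finset.sum_comm]
  refine Finset.sum_congr rfl fun n hn => ?_
  rw [← integral_finsetSum]
  · refine integral_congr_ae (ae_of_all _ fun x => ?_)
    simp [PiLp.inner_apply]
  · exact fun k _ => (h.integrableOn_facet (h.unit n hn) _ (hcoord k).continuousOn).const_mul _

/-! ### Local shape of a polytope at its facets -/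

lemma inner_lt_of_mem_interior {C : Set (Euc d)} {n : Euc d} (hn : ‖n‖ = 1) {t : ℝ}
    (ht : ∀ y ∈ C, ⟪n, y⟫ ≤ t) {x : Euc d} (hx : x ∈ interior C) : ⟪n, x⟫ < t := by
  obtain ⟨ε, hε, hball⟩ := Metric.isOpen_iff.1 isOpen_interior x hx
  have h1 : x + (ε / 2) • n ∈ C := interior_subset (hball (by
    rw [Metric.mem_ball, dist_self_add_left, norm_smul, hn, Real.norm_of_nonneg (by positivity)]
    linarith))
  have h2 := ht _ h1
  rw [inner_add_right, inner_smul_right, real_inner_self_eq_norm_sq, hn] at h2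
  linarith

/-- At almost every point that a polytope shares with a supporting hyperplane, the polytope is
locally a half-space, and the hyperplane belongs to one of the facets. -/
lemma ae_eventually_mem_iff (h : IsPolytopeWith C S c) {n : Euc d} (hn : ‖n‖ = 1) {t : ℝ}
    (ht : ∀ y ∈ C, ⟪n, y⟫ ≤ t) :
    ∀ᵐ x ∂(surf d).restrict (C ∩ hyperplane n t),
      n ∈ S ∧ c n = t ∧ ∀ᶠ y in 𝓝 x, (y ∈ C ↔ ⟪n, y - x⟫ ≤ 0) := by
  rw [ae_restrict_iff' (h.isCompact_facet n t).measurableSet]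
  -- The other bounding hyperplanes meet this one in null sets, or, for `m = -n`, would force width
  -- zero.
  have h1 : ∀ᵐ x ∂surf d, ∀ m ∈ S, m ≠ n → x ∈ C ∩ hyperplane n t → ⟪m, x⟫ ≠ c m := by
    refine (ae_ball_iff S.countable_toSet).2 fun m hm => ?_
    by_cases hmn : m = n
    · exact ae_of_all _ fun x h => absurd hmn h
    by_cases hmn' : m = -n
    · refine ae_of_all _ fun x _ hx hxm => ?_
      have h2 := h.neg_level_lt hn (s := t) (t := -c m) ht fun y hy => by
        have := (h.mem_iff y).1 hy m hm
        rw [hmn', inner_neg_left] at this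
        rw [hmn']
        linarith
      have h3 : ⟪n, x⟫ = t := hx.2
      rw [hmn', inner_neg_left] at hxm
      rw [hmn'] at h2
      linarith
    · filter_upwards [measure_eq_zero_iff_ae_notMem.1
        (surf_hyperplane_inter hn (h.unit m hm) hmn hmn' (c m) t)] with x hx _ hx2 hx3
      exact hx ⟨hx3, hx2.2⟩
  filter_upwards [h1] with x hx hxC
  have hlt : ∀ m ∈ S, m ≠ n → ⟪m, x⟫ < c m := fun m hm hmn =>
    lt_of_le_of_ne ((h.mem_iff x).1 hxC.1 m hm) (hx m hm hmn hxC)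
  have hev : ∀ m : Euc d, ⟪m, x⟫ < c m → ∀ᶠ y in 𝓝 x, ⟪m, y⟫ < c m := fun m hm => by
    have : Continuous fun y : Euc d => ⟪m, y⟫ := by fun_prop
    exact this.continuousAt.eventually_lt continuousAt_const hm
  have hxt : ⟪n, x⟫ = t := hxC.2
  have hnS : n ∈ S ∧ c n = t := by
    by_contra hcon
    -- If the supporting hyperplane were not one of the constraints, all constraints would be strict
    -- at `x`, which would make `x` an interior point on a supporting hyperplane.
    have hall : ∀ m ∈ S, ⟪m, x⟫ < c m := fun m hm => by
      by_cases hmn : m = n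
      · subst hmn
        refine lt_of_le_of_ne ((h.mem_iff x).1 hxC.1 m hm) fun heq => hcon ⟨hm, ?_⟩
        rw [← heq, hxt]
      · exact hlt m hm hmn
    have hint : x ∈ interior C := by
      rw [mem_interior_iff_mem_nhds]
      have h2 : ∀ᶠ y in 𝓝 x, ∀ m ∈ S, ⟪m, y⟫ < c m :=
        (Finset.eventually_all S).2 fun m hm => hev m (hall m hm)
      filter_upwards [h2] with y hy
      exact (h.mem_iff y).2 fun m hm => (hy m hm).le
    have := inner_lt_of_mem_interior hn ht hint
    linarith
  refine ⟨hnS.1, hnS.2, ?_⟩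
  have h2 : ∀ᶠ y in 𝓝 x, ∀ m ∈ S, m ≠ n → ⟪m, y⟫ < c m := by
    refine (Finset.eventually_all S).2 fun m hm => ?_
    by_cases hmn : m = n
    · exact Eventually.of_forall fun y h => absurd hmn h
    · filter_upwards [hev m (hlt m hm hmn)] with y hy _ using hy
  filter_upwards [h2] with y hy
  rw [inner_sub_right, hxt, sub_nonpos]
  refine ⟨ht y, fun hyt => (h.mem_iff y).2 fun m hm => ?_⟩
  by_cases hmn : m = n
  · rw [hmn, hnS.2]; exact hyt
  · exact (hy m hm hmn).le

end IsPolytopeWith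

/-! ### Facets of mesh cells and the divergence theorem on a cell -/

namespace Mesh

variable {M : Set (Euc d)} (𝓜 : Mesh M)

lemma cell_subset (i : Fin 𝓜.N) : 𝓜.cell i ⊆ M := by
  conv_rhs => rw [← 𝓜.cover]
  exact subset_iUnion _ i

lemma isClosed_cell (i : Fin 𝓜.N) : IsClosed (𝓜.cell i) := by
  obtain ⟨S, c, h⟩ := (𝓜.polytope i).exists_isPolytopeWith
  exact h.isClosed

lemma isCompact_cell (i : Fin 𝓜.N) : IsCompact (𝓜.cell i) := by
  obtain ⟨S, c, h⟩ := (𝓜.polytope i).exists_isPolytopeWith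
  exact h.isCompact

lemma convex_cell (i : Fin 𝓜.N) : Convex ℝ (𝓜.cell i) := by
  obtain ⟨S, c, h⟩ := (𝓜.polytope i).exists_isPolytopeWith
  exact h.convex

lemma closure_interior_cell (i : Fin 𝓜.N) : closure (interior (𝓜.cell i)) = 𝓜.cell i := by
  rw [(𝓜.convex_cell i).closure_interior_eq_closure_of_nonempty_interior (𝓜.polytope i).2.1,
    (𝓜.isClosed_cell i).closure_eq]

/-- Hahn–Banach separates the disjoint open interiors; the inequalities pass to the cells, which are
the closures of their interiors. -/
lemma exists_isNormal {i j : Fin 𝓜.N} (hij : i ≠ j) : ∃ n, 𝓜.IsNormal i j n := by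
  obtain ⟨f, u, h1, h2⟩ := geometric_hahn_banach_open_open (𝓜.convex_cell i).interior
    isOpen_interior (𝓜.convex_cell j).interior isOpen_interior (𝓜.disjoint_interior i j hij)
  set v : Euc d := (InnerProductSpace.toDual ℝ (Euc d)).symm f with hv
  have hf : ∀ x, f x = ⟪v, x⟫ := fun x => by
    rw [hv, InnerProductSpace.toDual_symm_apply]
  have hcont : Continuous fun x : Euc d => ⟪v, x⟫ := by fun_prop
  have hi : ∀ x ∈ 𝓜.cell i, ⟪v, x⟫ ≤ u := fun x hx => by
    rw [← 𝓜.closure_interior_cell i] at hx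
    exact closure_minimal (fun y hy => show ⟪v, y⟫ ≤ u by rw [← hf]; exact (h1 y hy).le)
      (isClosed_le hcont continuous_const) hx
  have hj : ∀ x ∈ 𝓜.cell j, u ≤ ⟪v, x⟫ := fun x hx => by
    rw [← 𝓜.closure_interior_cell j] at hx
    exact closure_minimal (fun y hy => show u ≤ ⟪v, y⟫ by rw [← hf]; exact (h2 y hy).le)
      (isClosed_le continuous_const hcont) hx
  have hv0 : v ≠ 0 := by
    intro hv0
    obtain ⟨x, hx⟩ := (𝓜.polytope i).2.1
    obtain ⟨y, hy⟩ := (𝓜.polytope j).2.1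
    have h3 := h1 x hx
    have h4 := h2 y hy
    rw [hf, hv0, inner_zero_left] at h3 h4
    linarith
  have hpos : 0 < ‖v‖ := norm_pos_iff.2 hv0
  refine ⟨‖v‖⁻¹ • v, norm_smul_inv_norm (𝕜 := ℝ) hv0, ‖v‖⁻¹ * u, fun x hx => ?_, fun x hx => ?_⟩
  · rw [real_inner_smul_left]
    gcongr
    exact hi x hx
  · rw [real_inner_smul_left]
    gcongr
    exact hj x hx

lemma isNormal_normal {i j : Fin 𝓜.N} (hij : i ≠ j) : 𝓜.IsNormal i j (𝓜.normal i j) :=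
  Classical.epsilon_spec (𝓜.exists_isNormal hij)

/-- Two different cells do not look like the same half-space near a common point. -/
lemma eq_of_eventually_mem_iff {j k : Fin 𝓜.N} {x n : Euc d} (hn : n ≠ 0)
    (hj : ∀ᶠ y in 𝓝 x, (y ∈ 𝓜.cell j ↔ ⟪n, y - x⟫ ≤ 0))
    (hk : ∀ᶠ y in 𝓝 x, (y ∈ 𝓜.cell k ↔ ⟪n, y - x⟫ ≤ 0)) : j = k := by
  by_contra hjk
  have hlim : Tendsto (fun s : ℝ => x - s • n) (𝓝[>] 0) (𝓝 x) := by
    have : Continuous fun s : ℝ => x - s • n := by fun_prop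
    have h1 := this.tendsto 0
    simp only [zero_smul, sub_zero] at h1
    exact h1.mono_left nhdsWithin_le_nhds
  have h2 := hlim.eventually (hj.and hk).eventually_nhds
  obtain ⟨s, hs, hs0⟩ := (h2.and self_mem_nhdsWithin).exists
  have hs0 : 0 < s := hs0
  have hneg : ⟪n, (x - s • n) - x⟫ < 0 := by
    rw [sub_sub_cancel_left, inner_neg_right, inner_smul_right, neg_lt_zero]
    exact mul_pos hs0 (real_inner_self_pos.2 hn)
  have hev : ∀ᶠ y in 𝓝 (x - s • n), ⟪n, y - x⟫ < 0 := by
    have : Continuous fun y : Euc d => ⟪n, y - x⟫ := by fun_prop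
    exact this.continuousAt.eventually_lt continuousAt_const hneg
  have hji : x - s • n ∈ interior (𝓜.cell j) := by
    rw [mem_interior_iff_mem_nhds]
    filter_upwards [hs, hev] with y hy hy2 using hy.1.2 hy2.le
  have hki : x - s • n ∈ interior (𝓜.cell k) := by
    rw [mem_interior_iff_mem_nhds]
    filter_upwards [hs, hev] with y hy hy2 using hy.2.2 hy2.le
  exact disjoint_left.1 (𝓜.disjoint_interior j k hjk) hji hki

section Facets

variable {i : Fin 𝓜.N} {S : Finset (Euc d)} {c : Euc d → ℝ}

lemma measurableSet_face (i j : Fin 𝓜.N) : MeasurableSet (𝓜.face i j) :=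
  ((𝓜.isClosed_cell i).inter (𝓜.isClosed_cell j)).measurableSet

/-- The hyperface has positive measure in a supporting hyperplane of cell `i`, so it contains a
point at which `ae_eventually_mem_iff` identifies this hyperplane as a constraint. This ties the
separating normal to the normals in the divergence theorem. -/
lemma normal_mem (h : IsPolytopeWith (𝓜.cell i) S c) {j : Fin 𝓜.N} (hj : 𝓜.Adj i j) :
    𝓜.normal i j ∈ S ∧ 𝓜.face i j ⊆ 𝓜.cell i ∩ hyperplane (𝓜.normal i j) (c (𝓜.normal i j)) ∧
      ∀ x ∈ 𝓜.cell j, c (𝓜.normal i j) ≤ ⟪𝓜.normal i j, x⟫ := by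
  obtain ⟨hn, t, h1, h2⟩ := 𝓜.isNormal_normal hj.1
  have hsub : 𝓜.face i j ⊆ 𝓜.cell i ∩ hyperplane (𝓜.normal i j) t := fun x hx =>
    ⟨hx.1, le_antisymm (h1 x hx.1) (h2 x hx.2)⟩
  have hae := h.ae_eventually_mem_iff hn h1
  have : NeZero ((surf d).restrict (𝓜.cell i ∩ hyperplane (𝓜.normal i j) t)) := by
    refine ⟨fun h0 => ?_⟩
    rw [Measure.restrict_eq_zero] at h0
    exact hj.2.ne' (measure_mono_null hsub h0)
  obtain ⟨x, hx⟩ := hae.exists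
  exact ⟨hx.1, by rw [hx.2.1]; exact hsub, by rw [hx.2.1]; exact h2⟩

/-- Almost every point of a facet of a cell is on exactly one hyperface with the same normal,
or it is a boundary point of `M` where `M` has the same outer normal. -/
lemma ae_facet (h : IsPolytopeWith (𝓜.cell i) S c) {n : Euc d} (hn : n ∈ S) :
    ∀ᵐ x ∂(surf d).restrict (𝓜.cell i ∩ hyperplane n (c n)),
      (∃ j, (𝓜.Adj i j ∧ 𝓜.normal i j = n) ∧ x ∈ 𝓜.cell j ∧
        ∀ k, 𝓜.Adj i k ∧ 𝓜.normal i k = n → x ∈ 𝓜.cell k → k = j) ∨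
      ((∀ j, 𝓜.Adj i j ∧ 𝓜.normal i j = n → x ∉ 𝓜.cell j) ∧ IsOuterUnitNormal M x n) := by
  have hn1 := h.unit n hn
  have hFm := (h.isCompact_facet n (c n)).measurableSet
  have h1 := h.ae_eventually_mem_iff hn1 fun y hy => (h.mem_iff y).1 hy n hn
  have h2 : ∀ᵐ x ∂(surf d).restrict (𝓜.cell i ∩ hyperplane n (c n)),
      ∀ j, j ≠ i → ¬ 𝓜.Adj i j → x ∉ 𝓜.cell j := by
    refine ae_all_iff.2 fun j => ?_
    by_cases hj : j ≠ i ∧ ¬ 𝓜.Adj i j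
    · have h0 : surf d (𝓜.face i j) = 0 := by
        by_contra h0
        exact hj.2 ⟨hj.1.symm, pos_iff_ne_zero.2 h0⟩
      rw [ae_restrict_iff' hFm]
      filter_upwards [measure_eq_zero_iff_ae_notMem.1 h0] with x hx hxF _ _ hxj
      exact hx ⟨hxF.1, hxj⟩
    · exact ae_of_all _ fun x a b => absurd ⟨a, b⟩ hj
  have h3 : ∀ᵐ x ∂(surf d).restrict (𝓜.cell i ∩ hyperplane n (c n)),
      ∀ j, 𝓜.Adj i j ∧ 𝓜.normal i j = n → x ∈ 𝓜.cell j →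
        ∀ᶠ y in 𝓝 x, (y ∈ 𝓜.cell j ↔ ⟪-n, y - x⟫ ≤ 0) := by
    refine ae_all_iff.2 fun j => ?_
    by_cases hj : 𝓜.Adj i j ∧ 𝓜.normal i j = n
    · obtain ⟨Sj, cj, hrep⟩ := (𝓜.polytope j).exists_isPolytopeWith
      have h4 := hrep.ae_eventually_mem_iff (n := -n) (t := -c n) (by rwa [norm_neg])
        fun y hy => by
          have := (𝓜.normal_mem h hj.1).2.2 y hy
          rw [hj.2] at this
          rw [inner_neg_left]
          linarith
      rw [ae_restrict_iff' (hrep.isCompact_facet _ _).measurableSet] at h4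
      rw [ae_restrict_iff' hFm]
      filter_upwards [h4] with x hx hxF _ hxj
      refine (hx ⟨hxj, ?_⟩).2.2
      change ⟪-n, x⟫ = -c n
      rw [inner_neg_left, neg_inj]
      exact hxF.2
    · exact ae_of_all _ fun x a => absurd a hj
  filter_upwards [h1, h2, h3, ae_restrict_mem hFm] with x hx1 hx2 hx3 hxF
  have hnn : -n ≠ 0 := by
    intro h0
    rw [neg_eq_zero.1 h0] at hn1
    simp at hn1
  by_cases hex : ∃ j, (𝓜.Adj i j ∧ 𝓜.normal i j = n) ∧ x ∈ 𝓜.cell j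
  · obtain ⟨j, hj, hxj⟩ := hex
    exact Or.inl ⟨j, hj, hxj, fun k hk hxk =>
      𝓜.eq_of_eventually_mem_iff hnn (hx3 k hk hxk) (hx3 j hj hxj)⟩
  · push Not at hex
    refine Or.inr ⟨hex, hn1, ?_⟩
    have hother : ∀ j, j ≠ i → x ∉ 𝓜.cell j := fun j hji hxj => by
      by_cases hadj : 𝓜.Adj i j
      · refine hex j ⟨hadj, ?_⟩ hxj
        obtain ⟨hm, t, ht1, ht2⟩ := 𝓜.isNormal_normal hadj.1
        have hmx : ⟪𝓜.normal i j, x⟫ = t := le_antisymm (ht1 x hxF.1) (ht2 x hxj)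
        set m := 𝓜.normal i j
        -- If `m ≠ n`, a small step from `x` along `m - n` stays in the half-space that cell `i` is
        -- near `x`, yet crosses the hyperplane separating it from cell `j`.
        have hlim : Tendsto (fun s : ℝ => x + s • (m - n)) (𝓝[>] 0) (𝓝 x) := by
          have : Continuous fun s : ℝ => x + s • (m - n) := by fun_prop
          have h1 := this.tendsto 0
          simp only [zero_smul, add_zero] at h1
          exact h1.mono_left nhdsWithin_le_nhds
        obtain ⟨s, hs, hs0⟩ := ((hlim.eventually hx1.2.2).and self_mem_nhdsWithin).exists
        have hs0 : 0 < s := hs0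
        have hle : ⟪n, m⟫ ≤ 1 := by
          have := real_inner_le_norm n m
          rwa [hn1, hm, one_mul] at this
        have hmem : x + s • (m - n) ∈ 𝓜.cell i := by
          rw [hs, add_sub_cancel_left, inner_smul_right, inner_sub_right,
            real_inner_self_eq_norm_sq, hn1]
          nlinarith
        have h4 := ht1 _ hmem
        rw [inner_add_right, hmx, inner_smul_right, inner_sub_right, real_inner_self_eq_norm_sq,
          hm, real_inner_comm] at h4
        refine ((inner_eq_one_iff_of_norm_eq_one hn1 hm).1 (le_antisymm hle ?_)).symm
        nlinarith
      · exact hx2 j hji hadj hxj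
    have hev : ∀ᶠ y in 𝓝 x, ∀ j, j ≠ i → y ∉ 𝓜.cell j := by
      refine eventually_all.2 fun j => ?_
      by_cases hji : j = i
      · exact Eventually.of_forall fun y a => absurd hji a
      · filter_upwards [(𝓜.isClosed_cell j).isOpen_compl.mem_nhds (hother j hji)] with y hy _
          using hy
    filter_upwards [hx1.2.2, hev] with y hy1 hy2
    rw [← hy1]
    refine ⟨fun hyM => ?_, fun hy => 𝓜.cell_subset i hy⟩
    rw [← 𝓜.cover] at hyM
    obtain ⟨j, hj⟩ := mem_iUnion.1 hyM
    by_cases hji : j = i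
    · rwa [← hji]
    · exact absurd hj (hy2 j hji)

-- The set `R` is the part of the facet in none of the neighbours behind it. By `ae_facet` the
-- neighbours tile the rest up to null sets, and `R` lies on the boundary of `M`, where a tangent
-- field has no flux.
open Classical in
lemma integral_facet (h : IsPolytopeWith (𝓜.cell i) S c) {n : Euc d} (hn : n ∈ S)
    {g : Euc d → ℝ} (hg : IntegrableOn g (𝓜.cell i ∩ hyperplane n (c n)) (surf d)) :
    ∃ R ⊆ 𝓜.cell i ∩ hyperplane n (c n), MeasurableSet R ∧
      (∀ᵐ x ∂(surf d).restrict R, IsOuterUnitNormal M x n) ∧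
      ∫ x in 𝓜.cell i ∩ hyperplane n (c n), g x ∂surf d =
        ∑ j with 𝓜.Adj i j ∧ 𝓜.normal i j = n, ∫ x in 𝓜.face i j, g x ∂surf d +
          ∫ x in R, g x ∂surf d := by
  set F := 𝓜.cell i ∩ hyperplane n (c n) with hF
  have hFm : MeasurableSet F := (h.isCompact_facet n (c n)).measurableSet
  set J : Finset (Fin 𝓜.N) := Finset.univ.filter fun j => 𝓜.Adj i j ∧ 𝓜.normal i j = n with hJ
  have hmemJ : ∀ j, j ∈ J ↔ 𝓜.Adj i j ∧ 𝓜.normal i j = n := fun j => by simp [hJ]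
  set R := F \ ⋃ j ∈ J, 𝓜.cell j with hR
  have hRm : MeasurableSet R := hFm.diff
    (Finset.measurableSet_biUnion J fun j _ => (𝓜.isClosed_cell j).measurableSet)
  have hRF : R ⊆ F := sdiff_subset
  have hsub : ∀ j ∈ J, 𝓜.face i j ⊆ F := fun j hj => by
    obtain ⟨h1, h2⟩ := (hmemJ j).1 hj
    have := (𝓜.normal_mem h h1).2.1
    rwa [h2] at this
  have hae := 𝓜.ae_facet h hn
  refine ⟨R, hRF, hRm, ?_, ?_⟩
  · filter_upwards [ae_mono (Measure.restrict_mono hRF le_rfl) hae, ae_restrict_mem hRm]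
      with x hx hxR
    rcases hx with ⟨j, hj, hxj, -⟩ | hx
    · exact absurd (mem_biUnion ((hmemJ j).2 hj) hxj) hxR.2
    · exact hx.2
  · rw [ae_restrict_iff' hFm] at hae
    have hpt : ∀ᵐ x ∂surf d, F.indicator g x =
        ∑ j ∈ J, (𝓜.face i j).indicator g x + R.indicator g x := by
      filter_upwards [hae] with x hx
      by_cases hxF : x ∈ F
      · have hface : ∀ j, x ∈ 𝓜.face i j ↔ x ∈ 𝓜.cell j := fun j =>
          ⟨fun h => h.2, fun h => ⟨hxF.1, h⟩⟩
        rw [indicator_of_mem hxF]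
        rcases hx hxF with ⟨j, hj, hxj, huniq⟩ | ⟨hnone, -⟩
        · rw [Finset.sum_eq_single_of_mem j ((hmemJ j).2 hj), indicator_of_mem ((hface j).2 hxj),
            indicator_of_notMem, add_zero]
          · exact fun hxR => hxR.2 (mem_biUnion ((hmemJ j).2 hj) hxj)
          · intro k hk hkj
            exact indicator_of_notMem (fun hxk =>
              hkj (huniq k ((hmemJ k).1 hk) ((hface k).1 hxk))) _
        · have hxR : x ∈ R := by
            refine ⟨hxF, fun hx => ?_⟩
            obtain ⟨j, hj, hxj⟩ := mem_iUnion₂.1 hx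
            exact hnone j ((hmemJ j).1 hj) hxj
          rw [indicator_of_mem hxR, Finset.sum_eq_zero, zero_add]
          intro j hj
          exact indicator_of_notMem (fun hxk =>
            hnone j ((hmemJ j).1 hj) ((hface j).1 hxk)) _
      · rw [indicator_of_notMem hxF, indicator_of_notMem (fun h => hxF (hRF h)),
          Finset.sum_eq_zero, add_zero]
        exact fun j hj => indicator_of_notMem (fun h => hxF (hsub j hj h)) _
    have hi : ∀ j ∈ J, Integrable ((𝓜.face i j).indicator g) (surf d) := fun j hj =>
      (hg.mono_set (hsub j hj)).integrable_indicator (𝓜.measurableSet_face i j)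
    rw [← integral_indicator hFm, integral_congr_ae hpt, integral_add (integrable_finsetSum _ hi)
      ((hg.mono_set hRF).integrable_indicator hRm), integral_finsetSum _ hi,
      integral_indicator hRm]
    congr 1
    exact Finset.sum_congr rfl fun j _ => integral_indicator (𝓜.measurableSet_face i j)

open Classical in
lemma sum_adj_eq_sum_normal (h : IsPolytopeWith (𝓜.cell i) S c)
    (G : Euc d → Fin 𝓜.N → ℝ) :
    ∑ j with 𝓜.Adj i j, G (𝓜.normal i j) j =
      ∑ n ∈ S, ∑ j with 𝓜.Adj i j ∧ 𝓜.normal i j = n, G n j := by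
  rw [← Finset.sum_fiberwise_of_maps_to (t := S) (g := fun j => 𝓜.normal i j)
    fun j hj => (𝓜.normal_mem h (Finset.mem_filter.1 hj).2).1]
  refine Finset.sum_congr rfl fun n _ => ?_
  rw [Finset.filter_filter]
  exact Finset.sum_congr rfl fun j hj => by rw [(Finset.mem_filter.1 hj).2.2]

end Facets

open Classical in
/-- The divergence theorem for a cell and a vector field that is tangent to the boundary of `M`. -/
theorem integral_divergence_cell (i : Fin 𝓜.N) {w : Euc d → Euc d} {K : ℝ≥0}
    (hw : LipschitzOnWith K w (𝓜.cell i)) (hwt : TangentToBoundary M w) :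
    ∫ x in 𝓜.cell i, divergence w x = ∑ j with 𝓜.Adj i j, 𝓜.flux w i j := by
  obtain ⟨S, c, h⟩ := (𝓜.polytope i).exists_isPolytopeWith
  rw [h.integral_divergence hw]
  simp only [flux]
  rw [𝓜.sum_adj_eq_sum_normal h fun n j => ∫ x in 𝓜.face i j, ⟪w x, n⟫ ∂surf d]
  refine Finset.sum_congr rfl fun n hn => ?_
  obtain ⟨R, -, -, hRn, hR⟩ := 𝓜.integral_facet h hn (g := fun x => ⟪w x, n⟫)
    (h.integrableOn_facet (h.unit n hn) _ (hw.continuousOn.inner continuousOn_const))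
  rw [hR, integral_eq_zero_of_ae, add_zero]
  filter_upwards [hRn] with x hx using hwt x n hx

lemma surf_face_lt_top {i j : Fin 𝓜.N} (hij : i ≠ j) : surf d (𝓜.face i j) < ⊤ := by
  obtain ⟨hn, t, h1, h2⟩ := 𝓜.isNormal_normal hij
  exact surf_lt_top_of_isBounded hn (t := t)
    (fun x hx => le_antisymm (h1 x hx.1) (h2 x hx.2)) ((𝓜.polytope i).1.subset inter_subset_left)

lemma isCompact_face (i j : Fin 𝓜.N) : IsCompact (𝓜.face i j) :=
  (𝓜.isCompact_cell i).inter_right (𝓜.isClosed_cell j)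

open Classical in
/-- The total surface of the hyperfaces of a cell is controlled by the volume and by the radius of
an inscribed ball. -/
lemma mul_sum_surf_face_le (i : Fin 𝓜.N) {z : Euc d} {r : ℝ} (hr : 0 ≤ r)
    (hball : Metric.closedBall z r ⊆ 𝓜.cell i) :
    r * ∑ j with 𝓜.Adj i j, (surf d).real (𝓜.face i j) ≤ d * 𝓜.vol i := by
  obtain ⟨S, c, h⟩ := (𝓜.polytope i).exists_isPolytopeWith
  -- The field `x - z` has divergence `d`, and its outward normal component is at least `r` on every
  -- facet because the ball lies on the inner side.
  have hw : LipschitzOnWith 1 (fun x : Euc d => x - z) (𝓜.cell i) :=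
    LipschitzOnWith.of_dist_le_mul fun x _ y _ => by simp
  have hdiv : ∀ x, divergence (fun x : Euc d => x - z) x = d := fun x => by
    rw [divergence, fderiv_sub_const, fderiv_fun_id]
    change LinearMap.trace ℝ (Euc d) LinearMap.id = d
    rw [LinearMap.trace_id, finrank_euclideanSpace_fin]
  have hdt := h.integral_divergence hw
  simp only [hdiv, setIntegral_const, smul_eq_mul] at hdt
  have hge : ∀ n ∈ S, ∀ x ∈ 𝓜.cell i ∩ hyperplane n (c n), r ≤ ⟪x - z, n⟫ := by
    intro n hn x hx
    have h1 := (h.mem_iff _).1 (hball (show z + r • n ∈ Metric.closedBall z r by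
      rw [Metric.mem_closedBall, dist_self_add_left, norm_smul, h.unit n hn,
        Real.norm_of_nonneg hr, mul_one])) n hn
    have h2 : ⟪n, x⟫ = c n := hx.2
    rw [inner_add_right, inner_smul_right, real_inner_self_eq_norm_sq, h.unit n hn] at h1
    rw [real_inner_comm, inner_sub_right, h2]
    linarith
  rw [mul_comm (d : ℝ), vol, hdt, Finset.mul_sum,
    𝓜.sum_adj_eq_sum_normal h fun _ j => r * (surf d).real (𝓜.face i j)]
  refine Finset.sum_le_sum fun n hn => ?_
  have hint : IntegrableOn (fun x => ⟪x - z, n⟫) (𝓜.cell i ∩ hyperplane n (c n)) (surf d) :=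
    h.integrableOn_facet (h.unit n hn) _ (hw.continuousOn.inner continuousOn_const)
  obtain ⟨R, hRF, hRm, -, hR⟩ := 𝓜.integral_facet h hn hint
  rw [hR]
  refine le_add_of_le_of_nonneg (Finset.sum_le_sum fun j hj => ?_)
    (setIntegral_nonneg hRm fun x hx => hr.trans (hge n hn x (hRF hx)))
  obtain ⟨hadj, hnorm⟩ := (Finset.mem_filter.1 hj).2
  have hsub : 𝓜.face i j ⊆ 𝓜.cell i ∩ hyperplane n (c n) := by
    have := (𝓜.normal_mem h hadj).2.1
    rwa [hnorm] at this
  rw [mul_comm]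
  have hc := setIntegral_mono_on (μ := surf d) (s := 𝓜.face i j) (f := fun _ => r)
    (integrableOn_const (𝓜.surf_face_lt_top hadj.1).ne) (hint.mono_set hsub)
    (𝓜.measurableSet_face i j) fun x hx => hge n hn x (hsub hx)
  rwa [setIntegral_const, smul_eq_mul] at hc

end Mesh

/-! ### From bounded weak derivatives to a Lipschitz bound -/

open scoped Convolution in
/-- The derivatives of a mollification are bounded by the weak derivatives. -/
lemma exists_hasFDerivAt_mollification {U : Set (Euc d)} (hU : IsOpen U) {v : Euc d → Euc d}
    (hv : MemLp v ∞ (volume.restrict U)) {Dv : Fin d → Euc d → Euc d}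
    (hD : ∀ k, IsWeakPartial U k v (Dv k)) {B : ℝ} (hB0 : 0 ≤ B)
    (hB : ∀ k, ∀ᵐ x ∂volume.restrict U, ‖Dv k x‖ ≤ B)
    (φ : ContDiffBump (0 : Euc d)) {x : Euc d} (hx : Metric.closedBall x φ.rOut ⊆ U) :
    ∃ T : Euc d →L[ℝ] Euc d, ‖T‖ ≤ d * B ∧
      HasFDerivAt (φ.normed volume ⋆[ContinuousLinearMap.lsmul ℝ ℝ, volume] U.indicator v) T x := by
  set ρ := φ.normed (volume : Measure (Euc d)) with hρ
  have hρc : HasCompactSupport ρ := φ.hasCompactSupport_normed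
  have hρd : ContDiff ℝ ∞ ρ := φ.contDiff_normed
  have hVi : LocallyIntegrable (U.indicator v) (volume : Measure (Euc d)) :=
    ((memLp_indicator_iff_restrict hU.measurableSet).2 hv).locallyIntegrable le_top
  refine ⟨_, ?_, hρc.hasFDerivAt_convolution_left _ (hρd.of_le (by simp)) hVi x⟩
  set T := (fderiv ℝ ρ ⋆[(ContinuousLinearMap.lsmul ℝ ℝ).precompL (Euc d), volume]
    U.indicator v) x with hT
  have hcoord : ∀ k : Fin d, ‖T (EuclideanSpace.single k 1)‖ ≤ B := fun k => by
    set e : Euc d := EuclideanSpace.single k 1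
    have hex : ConvolutionExistsAt (fderiv ℝ ρ) (U.indicator v) x
        ((ContinuousLinearMap.lsmul ℝ ℝ).precompL (Euc d)) volume :=
      (hρc.fderiv ℝ).convolutionExists_left _ (hρd.continuous_fderiv (by simp)) hVi x
    have h1 : T e = ∫ t, fderiv ℝ ρ t e • U.indicator v (x - t) := by
      rw [hT, convolution_def, ContinuousLinearMap.integral_apply hex]
      rfl
    have h2 : T e = ∫ z in U, fderiv ℝ ρ (x - z) e • v z := by
      rw [h1, ← integral_sub_left_eq_self _ volume x, ← integral_indicator hU.measurableSet]
      congr 1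
      ext1 z
      rw [sub_sub_cancel]
      by_cases hz : z ∈ U
      · rw [indicator_of_mem hz, indicator_of_mem hz]
      · rw [indicator_of_notMem hz, indicator_of_notMem hz, smul_zero]
    -- The reflected and translated kernel is an admissible test function because the ball around
    -- `x` lies in `U`. The sign from the reflection cancels the one in the weak derivative.
    set ζ : Euc d → ℝ := fun z => ρ (x - z) with hζ
    have hζd : ContDiff ℝ ∞ ζ := hρd.comp (contDiff_const.sub contDiff_id)
    have hζs : tsupport ζ ⊆ Metric.closedBall x φ.rOut := by
      refine closure_minimal (fun z hz => ?_) Metric.isClosed_closedBall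
      have h3 : x - z ∈ tsupport ρ := subset_tsupport _ hz
      rw [hρ, φ.tsupport_normed_eq, mem_closedBall_zero_iff] at h3
      rwa [Metric.mem_closedBall, dist_comm, dist_eq_norm]
    have hζc : HasCompactSupport ζ :=
      (isCompact_closedBall x φ.rOut).of_isClosed_subset (isClosed_tsupport _) hζs
    have hζder : ∀ z, fderiv ℝ ζ z e = -fderiv ℝ ρ (x - z) e := fun z => by
      have h3 : HasFDerivAt ζ ((fderiv ℝ ρ (x - z)).comp (-ContinuousLinearMap.id ℝ (Euc d))) z :=
        (hρd.differentiable (by simp) (x - z)).hasFDerivAt.comp z ((hasFDerivAt_id z).const_sub x)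
      rw [h3.fderiv]
      simp
    have h4 := hD k ζ hζd hζc (hζs.trans hx)
    have h5 : T e = ∫ z in U, ζ z • Dv k z := by
      have h6 : ∫ z in U, fderiv ℝ ζ z e • v z = -T e := by
        rw [h2, ← integral_neg]
        congr 1
        ext1 z
        rw [hζder, neg_smul]
      rw [h6] at h4
      exact neg_injective h4
    have hζ0 : ∀ z, 0 ≤ ζ z := fun z => φ.nonneg_normed _
    have hζi : Integrable ζ := hζd.continuous.integrable_of_hasCompactSupport hζc
    have hζ1 : ∫ z, ζ z = 1 := by
      rw [hζ, integral_sub_left_eq_self ρ volume x]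
      exact φ.integral_normed
    rw [h5]
    calc ‖∫ z in U, ζ z • Dv k z‖ ≤ ∫ z in U, ζ z * B := by
          refine norm_integral_le_of_norm_le (hζi.integrableOn.mul_const B) ?_
          filter_upwards [hB k] with z hz
          rw [norm_smul, Real.norm_of_nonneg (hζ0 z)]
          exact mul_le_mul_of_nonneg_left hz (hζ0 z)
      _ = (∫ z in U, ζ z) * B := integral_mul_const _ _
      _ ≤ (∫ z, ζ z) * B := by
          exact mul_le_mul_of_nonneg_right (setIntegral_le_integral hζi (ae_of_all _ hζ0)) hB0
      _ = B := by rw [hζ1, one_mul]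
  refine ContinuousLinearMap.opNorm_le_bound _ (by positivity) fun y => ?_
  have hy : y = ∑ k, y k • (EuclideanSpace.single k (1 : ℝ) : Euc d) := by
    have := ((EuclideanSpace.basisFun (Fin d) ℝ).sum_repr y).symm
    simpa using this
  calc ‖T y‖ = ‖∑ k, y k • T (EuclideanSpace.single k 1)‖ := by
        conv_lhs => rw [hy]
        rw [map_sum]
        simp_rw [map_smul]
    _ ≤ ∑ k : Fin d, ‖y‖ * B := norm_sum_le_of_le _ fun k _ => by
        rw [norm_smul]
        gcongr
        · exact PiLp.norm_apply_le y k
        · exact hcoord k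
    _ = d * B * ‖y‖ := by
        rw [Finset.sum_const, Finset.card_univ, Fintype.card_fin, nsmul_eq_mul]
        ring

open scoped Convolution in
/-- A continuous function with bounded weak derivatives is Lipschitz on convex sets. -/
lemma exists_lipschitzOnWith_of_isWeakPartial {U : Set (Euc d)} (hU : IsOpen U)
    {v : Euc d → Euc d} (hvc : ContinuousOn v U) (hv : MemLp v ∞ (volume.restrict U))
    {Dv : Fin d → Euc d → Euc d} (hDv : ∀ k, MemLp (Dv k) ∞ (volume.restrict U))
    (hD : ∀ k, IsWeakPartial U k v (Dv k)) :
    ∃ L : ℝ≥0, ∀ K ⊆ U, Convex ℝ K → LipschitzOnWith L v K := by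
  obtain ⟨B, hB0, hB⟩ : ∃ B : ℝ, 0 ≤ B ∧ ∀ k, ∀ᵐ x ∂volume.restrict U, ‖Dv k x‖ ≤ B := by
    refine ⟨∑ k, (eLpNorm (Dv k) ∞ (volume.restrict U)).toReal, by positivity, fun k => ?_⟩
    filter_upwards [ae_le_eLpNormEssSup (f := Dv k) (μ := volume.restrict U)] with x hx
    have hfin : eLpNorm (Dv k) ∞ (volume.restrict U) ≠ ⊤ := (hDv k).2.ne
    have h1 : ‖Dv k x‖ ≤ (eLpNorm (Dv k) ∞ (volume.restrict U)).toReal := by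
      rw [← toReal_enorm]
      exact ENNReal.toReal_mono hfin (by rwa [eLpNorm_exponent_top])
    exact h1.trans (Finset.single_le_sum
      (f := fun k => (eLpNorm (Dv k) ∞ (volume.restrict U)).toReal)
      (fun _ _ => ENNReal.toReal_nonneg) (Finset.mem_univ k))
  refine ⟨(d * B).toNNReal, fun K hKU hK => LipschitzOnWith.of_dist_le_mul fun x hx y hy => ?_⟩
  rw [Real.coe_toNNReal _ (by positivity)]
  have hseg : segment ℝ x y ⊆ U := (hK.segment_subset hx hy).trans hKU
  have hsegc : IsCompact (segment ℝ x y) := by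
    rw [segment_eq_image_lineMap]
    exact isCompact_Icc.image (by fun_prop)
  -- All mollification radii stay below `δ`, so the derivative bound holds along the whole segment.
  obtain ⟨δ, hδ, hδU⟩ := hsegc.exists_cthickening_subset_open hU hseg
  let φ : ℕ → ContDiffBump (0 : Euc d) := fun m =>
    ⟨δ / (m + 1) / 2, δ / (m + 1), by positivity, half_lt_self (by positivity)⟩
  have hφle : ∀ m, (φ m).rOut ≤ δ := fun m => div_le_self hδ.le (by
    have : (0 : ℝ) ≤ m := m.cast_nonneg
    linarith)
  have hφlim : Tendsto (fun m => (φ m).rOut) atTop (𝓝 0) := by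
    have h1 := (tendsto_one_div_add_atTop_nhds_zero_nat (𝕜 := ℝ)).const_mul δ
    rw [mul_zero] at h1
    refine h1.congr fun m => ?_
    change δ * (1 / ((m : ℝ) + 1)) = δ / (m + 1)
    ring
  set W : ℕ → Euc d → Euc d := fun m =>
    (φ m).normed volume ⋆[ContinuousLinearMap.lsmul ℝ ℝ, volume] U.indicator v with hW
  have hlim : ∀ z ∈ segment ℝ x y, Tendsto (fun m => W m z) atTop (𝓝 (v z)) := fun z hz => by
    have hcont : ContinuousAt (U.indicator v) z := by
      have h1 := (hvc z (hseg hz)).continuousAt (hU.mem_nhds (hseg hz))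
      refine h1.congr ?_
      filter_upwards [hU.mem_nhds (hseg hz)] with t ht using (indicator_of_mem ht v).symm
    have h2 := hcont.tendsto
    rw [indicator_of_mem (hseg hz)] at h2
    refine ContDiffBump.convolution_tendsto_right (g := fun _ => U.indicator v) hφlim
      (Eventually.of_forall fun _ => ?_) (h2.comp tendsto_snd) tendsto_const_nhds
    exact ((memLp_indicator_iff_restrict hU.measurableSet).2 hv).1
  have hbound : ∀ m, ‖W m x - W m y‖ ≤ d * B * ‖x - y‖ := fun m => by
    have hder : ∀ z ∈ segment ℝ x y, ∃ T : Euc d →L[ℝ] Euc d, ‖T‖ ≤ d * B ∧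
        HasFDerivAt (W m) T z := fun z hz =>
      exists_hasFDerivAt_mollification hU hv hD hB0 hB (φ m) fun t ht =>
        hδU (Metric.mem_cthickening_of_dist_le t z δ _ hz
          ((Metric.mem_closedBall.1 ht).trans (hφle m)))
    choose! T hT1 hT2 using hder
    exact (convex_segment x y).norm_image_sub_le_of_norm_hasFDerivWithin_le
      (fun z hz => (hT2 z hz).hasFDerivWithinAt) hT1 (right_mem_segment ℝ x y)
      (left_mem_segment ℝ x y)
  rw [dist_eq_norm, dist_eq_norm]
  exact le_of_tendsto (((hlim x (left_mem_segment ℝ x y)).sub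
    (hlim y (right_mem_segment ℝ x y))).norm) (Eventually.of_forall hbound)

/-- The constant depends only on bounds over the interior of `M`, hence serves all meshes. Interiors
of cells are convex subsets of it, and continuity extends the bound to the closed cells. -/
lemma MemW2Infty.exists_lipschitzOnWith_cell {M : Set (Euc d)} {u : Euc d → Euc d}
    (hu : MemW2Infty (interior M) u) (huc : ContinuousOn u M) :
    ∃ L : ℝ≥0, ∀ (𝓜 : Mesh M) (i : Fin 𝓜.N), LipschitzOnWith L u (𝓜.cell i) := by
  obtain ⟨hu0, Du, -, hDu, -⟩ := hu
  obtain ⟨L, hL⟩ := exists_lipschitzOnWith_of_isWeakPartial isOpen_interior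
    (huc.mono interior_subset) hu0 (fun k => (hDu k).1) fun k => (hDu k).2
  refine ⟨L, fun 𝓜 i => ?_⟩
  have h1 := hL _ (interior_mono (𝓜.cell_subset i)) (𝓜.convex_cell i).interior
  rw [← 𝓜.closure_interior_cell i]
  refine h1.closure (huc.mono ?_)
  rw [𝓜.closure_interior_cell i]
  exact 𝓜.cell_subset i

lemma abs_divergence_le {C : Set (Euc d)} {u : Euc d → Euc d} {L : ℝ≥0}
    (hu : LipschitzOnWith L u C) {x : Euc d} (hx : x ∈ interior C) :
    |divergence u x| ≤ d * L := by
  have hnorm : ‖fderiv ℝ u x‖ ≤ L :=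
    norm_fderiv_le_of_lipschitzOn ℝ (mem_interior_iff_mem_nhds.1 hx) hu
  rw [divergence_eq_sum, ← Real.norm_eq_abs]
  refine (norm_sum_le_of_le (f := fun k => fderiv ℝ u x (EuclideanSpace.single k 1) k)
    (n := fun _ : Fin d => (L : ℝ)) _ fun k _ => ?_).trans (by simp)
  refine (PiLp.norm_apply_le _ k).trans ((ContinuousLinearMap.le_opNorm _ _).trans ?_)
  simpa using hnorm

lemma divergence_smul {u : Euc d → Euc d} {x : Euc d} (hu : DifferentiableAt ℝ u x)
    (g : Euc d →L[ℝ] ℝ) (y : Euc d) :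
    divergence (fun x => g (x - y) • u x) x = g (x - y) * divergence u x + g (u x) := by
  have h1 : HasFDerivAt (fun x => g (x - y)) g x := by
    exact g.hasFDerivAt.comp x ((hasFDerivAt_id x).sub_const y)
  have h2 : HasFDerivAt (fun x => g (x - y) • u x)
      (g (x - y) • fderiv ℝ u x + g.smulRight (u x)) x := h1.smul hu.hasFDerivAt
  rw [divergence, h2.fderiv]
  simp only [ContinuousLinearMap.toLinearMap_add, ContinuousLinearMap.toLinearMap_smul, map_add,
    map_smul, smul_eq_mul,
    divergence]
  congr 1
  exact LinearMap.trace_smulRight (g : Euc d →ₗ[ℝ] ℝ) (u x)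

/-! ### Barycenters and basic bounds on cells -/

namespace Mesh

variable {M : Set (Euc d)} (𝓜 : Mesh M)

lemma isCompact (𝓜 : Mesh M) : IsCompact M := by
  rw [← 𝓜.cover]
  exact isCompact_iUnion 𝓜.isCompact_cell

lemma uniqueDiffOn (𝓜 : Mesh M) : UniqueDiffOn ℝ M := fun x hx => by
  rw [← 𝓜.cover] at hx
  obtain ⟨i, hi⟩ := mem_iUnion.1 hx
  exact (uniqueDiffOn_convex (𝓜.convex_cell i) (𝓜.polytope i).2.1 x hi).mono (𝓜.cell_subset i)

lemma diam_cell_le_size (i : Fin 𝓜.N) : Metric.diam (𝓜.cell i) ≤ 𝓜.size :=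
  le_ciSup (finite_range fun i => Metric.diam (𝓜.cell i)).bddAbove i

lemma norm_sub_le_size {i : Fin 𝓜.N} {x y : Euc d} (hx : x ∈ 𝓜.cell i) (hy : y ∈ 𝓜.cell i) :
    ‖x - y‖ ≤ 𝓜.size := by
  rw [← dist_eq_norm]
  exact (Metric.dist_le_diam_of_mem (𝓜.polytope i).1 hx hy).trans (𝓜.diam_cell_le_size i)

lemma volume_cell_pos (i : Fin 𝓜.N) : 0 < volume (𝓜.cell i) :=
  (isOpen_interior.measure_pos volume (𝓜.polytope i).2.1).trans_le (measure_mono interior_subset)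

lemma vol_pos (i : Fin 𝓜.N) : 0 < 𝓜.vol i :=
  ENNReal.toReal_pos (𝓜.volume_cell_pos i).ne' (𝓜.isCompact_cell i).measure_lt_top.ne

lemma integrableOn_cell {F : Type*} [NormedAddCommGroup F] {f : Euc d → F} {i : Fin 𝓜.N}
    (hf : ContinuousOn f (𝓜.cell i)) : IntegrableOn f (𝓜.cell i) :=
  hf.integrableOn_compact (𝓜.isCompact_cell i)

lemma integrableOn_face {F : Type*} [NormedAddCommGroup F] {f : Euc d → F} {i j : Fin 𝓜.N}
    (hij : i ≠ j) (hf : ContinuousOn f (𝓜.face i j)) : IntegrableOn f (𝓜.face i j) (surf d) :=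
  integrableOn_of_continuousOn_of_isCompact (𝓜.isCompact_face i j) (𝓜.surf_face_lt_top hij).ne hf

lemma cellBary_mem (i : Fin 𝓜.N) : 𝓜.cellBary i ∈ 𝓜.cell i :=
  (𝓜.convex_cell i).set_average_mem (𝓜.isClosed_cell i) (𝓜.volume_cell_pos i).ne'
    (𝓜.isCompact_cell i).measure_lt_top.ne
    (ae_restrict_mem (𝓜.isClosed_cell i).measurableSet) (𝓜.integrableOn_cell continuousOn_id)

lemma faceBary_mem {i j : Fin 𝓜.N} (h : 𝓜.Adj i j) : 𝓜.faceBary i j ∈ 𝓜.face i j :=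
  ((𝓜.convex_cell i).inter (𝓜.convex_cell j)).set_average_mem (𝓜.isCompact_face i j).isClosed
    h.2.ne' (𝓜.surf_face_lt_top h.1).ne
    (ae_restrict_mem (𝓜.measurableSet_face i j)) (𝓜.integrableOn_face h.1 continuousOn_id)

lemma integral_cell_id (i : Fin 𝓜.N) : ∫ x in 𝓜.cell i, x = 𝓜.vol i • 𝓜.cellBary i := by
  rw [cellBary, setAverage_eq, smul_smul, vol, mul_inv_cancel₀, one_smul]
  exact (𝓜.vol_pos i).ne'

lemma surf_face_real_pos {i j : Fin 𝓜.N} (h : 𝓜.Adj i j) : 0 < (surf d).real (𝓜.face i j) :=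
  ENNReal.toReal_pos h.2.ne' (𝓜.surf_face_lt_top h.1).ne

lemma integral_face_bary_sub {i j : Fin 𝓜.N} (h : 𝓜.Adj i j) (g : Euc d →L[ℝ] ℝ) :
    ∫ x in 𝓜.face i j, g (𝓜.faceBary i j - x) ∂surf d = 0 := by
  have hfin := (𝓜.surf_face_lt_top h.1).ne
  have hid : IntegrableOn (fun x => x) (𝓜.face i j) (surf d) :=
    𝓜.integrableOn_face h.1 continuousOn_id
  have hc : IntegrableOn (fun _ : Euc d => 𝓜.faceBary i j) (𝓜.face i j) (surf d) :=
    integrableOn_const hfin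
  have h1 : ∫ x in 𝓜.face i j, (𝓜.faceBary i j - x) ∂surf d = 0 := by
    rw [integral_sub hc hid, setIntegral_const, faceBary, setAverage_eq, smul_smul,
      mul_inv_cancel₀ (𝓜.surf_face_real_pos h).ne', one_smul, sub_self]
  have hi : IntegrableOn (fun x => 𝓜.faceBary i j - x) (𝓜.face i j) (surf d) := hc.sub hid
  rw [g.integral_comp_comm hi, h1, map_zero]

/-! ### Taylor expansion of cell averages -/

section Taylor

variable {f : Euc d → ℝ} {f' : Euc d → Euc d →L[ℝ] ℝ} {K : ℝ}

lemma abs_taylor_le (hK0 : 0 ≤ K) {j : Fin 𝓜.N}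
    (hf : ∀ x ∈ 𝓜.cell j, HasFDerivWithinAt f (f' x) (𝓜.cell j) x)
    (hK : ∀ x ∈ 𝓜.cell j, ∀ y ∈ 𝓜.cell j, ‖f' x - f' y‖ ≤ K * ‖x - y‖)
    {p x : Euc d} (hp : p ∈ 𝓜.cell j) (hx : x ∈ 𝓜.cell j) :
    |f x - f p - f' p (x - p)| ≤ K * 𝓜.size ^ 2 := by
  have h1 := (𝓜.convex_cell j).norm_image_sub_le_of_norm_hasFDerivWithin_le' (φ := f' p)
    (C := K * 𝓜.size) hf (fun z hz => (hK z hz p hp).trans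
      (mul_le_mul_of_nonneg_left (𝓜.norm_sub_le_size hz hp) hK0)) hp hx
  have h2 := 𝓜.norm_sub_le_size hx hp
  have h3 : 0 ≤ 𝓜.size := (norm_nonneg _).trans h2
  calc |f x - f p - f' p (x - p)| ≤ K * 𝓜.size * ‖x - p‖ := h1
    _ ≤ K * 𝓜.size * 𝓜.size := by gcongr
    _ = K * 𝓜.size ^ 2 := by ring

/-- Averaging the affine Taylor polynomial over the cell evaluates it at the barycenter; only the
remainder is left. -/
lemma abs_proj_sub_le (hK0 : 0 ≤ K) {j : Fin 𝓜.N}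
    (hf : ∀ x ∈ 𝓜.cell j, HasFDerivWithinAt f (f' x) (𝓜.cell j) x)
    (hK : ∀ x ∈ 𝓜.cell j, ∀ y ∈ 𝓜.cell j, ‖f' x - f' y‖ ≤ K * ‖x - y‖)
    {p : Euc d} (hp : p ∈ 𝓜.cell j) :
    |𝓜.proj f j - f p - f' p (𝓜.cellBary j - p)| ≤ K * 𝓜.size ^ 2 := by
  have hfin := (𝓜.isCompact_cell j).measure_lt_top (μ := volume)
  have hfi : IntegrableOn f (𝓜.cell j) :=
    𝓜.integrableOn_cell fun x hx => (hf x hx).continuousWithinAt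
  have hid : IntegrableOn (fun x : Euc d => x) (𝓜.cell j) := 𝓜.integrableOn_cell continuousOn_id
  have hgi : IntegrableOn (fun x => f' p (x - p)) (𝓜.cell j) :=
    𝓜.integrableOn_cell (by fun_prop)
  have hc : IntegrableOn (fun _ : Euc d => f p) (𝓜.cell j) := integrableOn_const hfin.ne
  have hcp : IntegrableOn (fun _ : Euc d => p) (𝓜.cell j) := integrableOn_const hfin.ne
  have h1 : ∫ x in 𝓜.cell j, f' p (x - p) = 𝓜.vol j * f' p (𝓜.cellBary j - p) := by
    have hi : IntegrableOn (fun x : Euc d => x - p) (𝓜.cell j) := hid.sub hcp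
    rw [(f' p).integral_comp_comm hi, integral_sub hid hcp, integral_cell_id,
      setIntegral_const, ← vol, ← smul_sub, map_smul, smul_eq_mul]
  have h2 : ∫ x in 𝓜.cell j, (f x - f p - f' p (x - p)) =
      𝓜.vol j * (𝓜.proj f j - f p - f' p (𝓜.cellBary j - p)) := by
    have hi : IntegrableOn (fun x => f x - f p) (𝓜.cell j) := hfi.sub hc
    rw [integral_sub hi hgi, integral_sub hfi hc, h1, setIntegral_const, ← vol,
      smul_eq_mul, proj]
    have := (𝓜.vol_pos j).ne'
    field_simp
  have h3 := norm_setIntegral_le_of_norm_le_const (μ := volume) hfin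
    (f := fun x => f x - f p - f' p (x - p)) fun x hx => 𝓜.abs_taylor_le hK0 hf hK hp hx
  rw [h2, Real.norm_eq_abs, abs_mul, abs_of_pos (𝓜.vol_pos j), ← vol, mul_comm] at h3
  exact le_of_mul_le_mul_right h3 (𝓜.vol_pos j)

/-- Expand both averages at the face barycenter `p`, which belongs to both cells. With `x_j - x_i =
2 (p - x_i) + 2 ((x_i + x_j)/2 - p)`, the mesh condition controls the last term. The four `K` are
two remainders and twice the change of derivative from `p` to `x_i`. -/
lemma abs_proj_sub_proj_le (hK0 : 0 ≤ K)
    (hf : ∀ j, ∀ x ∈ 𝓜.cell j, HasFDerivWithinAt f (f' x) (𝓜.cell j) x)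
    (hK : ∀ j, ∀ x ∈ 𝓜.cell j, ∀ y ∈ 𝓜.cell j, ‖f' x - f' y‖ ≤ K * ‖x - y‖)
    {B : ℝ} (hB0 : 0 ≤ B) (hB : ∀ x ∈ M, ‖f' x‖ ≤ B) {i j : Fin 𝓜.N} (hij : 𝓜.Adj i j) {P : ℝ}
    (hP : ‖(1 / 2 : ℝ) • (𝓜.cellBary i + 𝓜.cellBary j) - 𝓜.faceBary i j‖ ≤ P) :
    |𝓜.proj f j - 𝓜.proj f i - 2 * f' (𝓜.cellBary i) (𝓜.faceBary i j - 𝓜.cellBary i)| ≤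
      4 * K * 𝓜.size ^ 2 + 2 * B * P := by
  have hp := 𝓜.faceBary_mem hij
  set p := 𝓜.faceBary i j
  set xi := 𝓜.cellBary i
  set xj := 𝓜.cellBary j
  have hxi : xi ∈ 𝓜.cell i := 𝓜.cellBary_mem i
  have h1 := 𝓜.abs_proj_sub_le hK0 (hf i) (hK i) hp.1
  have h2 := 𝓜.abs_proj_sub_le hK0 (hf j) (hK j) hp.2
  have h3 : |f' p ((1 / 2 : ℝ) • (xi + xj) - p)| ≤ B * P :=
    ((f' p).le_opNorm _).trans (mul_le_mul (hB p (𝓜.cell_subset i hp.1)) hP (norm_nonneg _) hB0)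
  have h4 : |(f' p - f' xi) (p - xi)| ≤ K * 𝓜.size ^ 2 := by
    have h5 := 𝓜.norm_sub_le_size hp.1 hxi
    have h6 : 0 ≤ 𝓜.size := (norm_nonneg _).trans h5
    calc |(f' p - f' xi) (p - xi)| ≤ ‖f' p - f' xi‖ * ‖p - xi‖ := (f' p - f' xi).le_opNorm _
      _ ≤ (K * ‖p - xi‖) * ‖p - xi‖ := by gcongr; exact hK i p hp.1 xi hxi
      _ ≤ (K * 𝓜.size) * 𝓜.size := by gcongr
      _ = K * 𝓜.size ^ 2 := by ring
  have h5 : 𝓜.proj f j - 𝓜.proj f i - 2 * f' xi (p - xi) =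
      (𝓜.proj f j - f p - f' p (xj - p)) - (𝓜.proj f i - f p - f' p (xi - p)) +
        2 * f' p ((1 / 2 : ℝ) • (xi + xj) - p) + 2 * (f' p - f' xi) (p - xi) := by
    simp only [map_sub, map_smul, map_add, smul_eq_mul, sub_apply]
    ring
  rw [h5]
  rw [abs_le] at h1 h2 h3 h4 ⊢
  constructor <;> linarith [h1.1, h1.2, h2.1, h2.2, h3.1, h3.2, h4.1, h4.2]

end Taylor

/-! ### The velocity matrix as a sum of flux differences -/

open Classical in
lemma velocityMatrix_mulVec (u : Euc d → Euc d) (F : Fin 𝓜.N → ℝ) (i : Fin 𝓜.N) :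
    (𝓜.velocityMatrix u *ᵥ F) i = 1 / (2 * 𝓜.vol i) *
      ((∫ x in 𝓜.cell i, divergence u x) * F i - ∑ j with 𝓜.Adj i j, 𝓜.flux u i j * F j) := by
  have h1 : ∀ j, 𝓜.velocityMatrix u i j * F j =
      (if j = i then 1 / (2 * 𝓜.vol i) * (∫ x in 𝓜.cell i, divergence u x) * F i else 0) -
        (if 𝓜.Adj i j then 1 / (2 * 𝓜.vol i) * (𝓜.flux u i j * F j) else 0) := fun j => by
    rw [velocityMatrix, Matrix.of_apply]
    by_cases hij : i = j
    · subst hij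
      have : ¬ 𝓜.Adj i i := fun h => h.1 rfl
      simp [this]
    · rw [if_neg hij, if_neg (Ne.symm hij)]
      split_ifs <;> ring
  rw [Matrix.mulVec, dotProduct, Finset.sum_congr rfl fun j _ => h1 j, Finset.sum_sub_distrib,
    Finset.sum_ite_eq' Finset.univ i, ← Finset.sum_filter, ← Finset.mul_sum]
  simp only [Finset.mem_univ, if_true]
  ring

lemma velocityMatrix_mem_sparse {u : Euc d → Euc d} {L : ℝ≥0}
    (hu : ∀ i, LipschitzOnWith L u (𝓜.cell i)) (hut : TangentToBoundary M u) :
    𝓜.velocityMatrix u ∈ 𝓜.sparse := by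
  constructor
  · ext i
    rw [velocityMatrix_mulVec, 𝓜.integral_divergence_cell i (hu i) hut]
    simp
  · intro i j hj
    have h1 : ¬ (j = i ∨ 𝓜.Adj i j) := hj
    rw [not_or] at h1
    rw [velocityMatrix, Matrix.of_apply, if_neg (Ne.symm h1.1), if_neg h1.2]

open Classical in
lemma velocityMatrix_mulVec_eq_sum {u : Euc d → Euc d} {L : ℝ≥0}
    (hu : ∀ i, LipschitzOnWith L u (𝓜.cell i)) (hut : TangentToBoundary M u)
    (F : Fin 𝓜.N → ℝ) (i : Fin 𝓜.N) :
    2 * 𝓜.vol i * (𝓜.velocityMatrix u *ᵥ F) i =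
      -∑ j with 𝓜.Adj i j, 𝓜.flux u i j * (F j - F i) := by
  rw [velocityMatrix_mulVec, 𝓜.integral_divergence_cell i (hu i) hut, ← mul_assoc,
    mul_one_div_cancel (mul_pos two_pos (𝓜.vol_pos i)).ne', one_mul, Finset.sum_mul,
    ← Finset.sum_sub_distrib, ← Finset.sum_neg_distrib]
  exact Finset.sum_congr rfl fun j _ => by ring

/-! ### Replacing the discrete sum by the flux of an affine multiple of `u` -/

section Flux

variable {u : Euc d → Euc d} {L : ℝ≥0} {U B : ℝ}

lemma abs_flux_le {i j : Fin 𝓜.N} (hij : i ≠ j) (hU : ∀ x ∈ M, ‖u x‖ ≤ U) :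
    |𝓜.flux u i j| ≤ U * (surf d).real (𝓜.face i j) := by
  have hn := (𝓜.isNormal_normal hij).1
  refine norm_setIntegral_le_of_norm_le_const (f := fun x => ⟪u x, 𝓜.normal i j⟫)
    (𝓜.surf_face_lt_top hij) fun x hx => ?_
  refine (norm_inner_le_norm _ _).trans ?_
  rw [hn, mul_one]
  exact hU x (𝓜.cell_subset i hx.1)

/-- The difference is the integral of `⟪u x, n⟫ g(p - x)`. Since `g(p - x)` integrates to zero over
the hyperface, `u x` may be replaced by `u x - u p`, which gains a second factor `h`. -/
lemma abs_flux_mul_sub_le {i j : Fin 𝓜.N} (hij : 𝓜.Adj i j)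
    (hu : LipschitzOnWith L u (𝓜.cell i)) (hB0 : 0 ≤ B) {g : Euc d →L[ℝ] ℝ} (hg : ‖g‖ ≤ B)
    (y : Euc d) :
    |𝓜.flux u i j * g (𝓜.faceBary i j - y) - 𝓜.flux (fun x => g (x - y) • u x) i j| ≤
      L * B * 𝓜.size ^ 2 * (surf d).real (𝓜.face i j) := by
  have hp := 𝓜.faceBary_mem hij
  have hn := (𝓜.isNormal_normal hij.1).1
  set p := 𝓜.faceBary i j with hpdef
  set n := 𝓜.normal i j with hndef
  have huc : ContinuousOn u (𝓜.face i j) := hu.continuousOn.mono inter_subset_left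
  have hgc : ContinuousOn (fun x => g (x - y)) (𝓜.face i j) := by fun_prop
  have hi1 : IntegrableOn (fun x => ⟪u x, n⟫ * g (p - y)) (𝓜.face i j) (surf d) :=
    𝓜.integrableOn_face hij.1 ((huc.inner continuousOn_const).mul continuousOn_const)
  have hi2 : IntegrableOn (fun x => ⟪g (x - y) • u x, n⟫) (𝓜.face i j) (surf d) :=
    𝓜.integrableOn_face hij.1 ((hgc.smul huc).inner continuousOn_const)
  have hi3 : IntegrableOn (fun x => ⟪u p, n⟫ * g (p - x)) (𝓜.face i j) (surf d) :=
    𝓜.integrableOn_face hij.1 (by fun_prop)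
  have h1 : 𝓜.flux u i j * g (p - y) - 𝓜.flux (fun x => g (x - y) • u x) i j =
      ∫ x in 𝓜.face i j, ⟪u x - u p, n⟫ * g (p - x) ∂surf d := by
    have h2 : ∫ x in 𝓜.face i j, ⟪u p, n⟫ * g (p - x) ∂surf d = 0 := by
      rw [integral_const_mul, 𝓜.integral_face_bary_sub hij, mul_zero]
    have hi12 : IntegrableOn (fun x => ⟪u x, n⟫ * g (p - y) - ⟪g (x - y) • u x, n⟫)
      (𝓜.face i j) (surf d) := hi1.sub hi2
    rw [flux, flux, ← integral_mul_const, ← integral_sub hi1 hi2,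
      ← sub_zero (∫ x in 𝓜.face i j, _ ∂surf d), ← h2, ← integral_sub hi12 hi3]
    refine integral_congr_ae (ae_of_all _ fun x => ?_)
    simp only [inner_sub_left, real_inner_smul_left, map_sub]
    ring
  rw [h1]
  refine norm_setIntegral_le_of_norm_le_const (f := fun x => ⟪u x - u p, n⟫ * g (p - x))
    (𝓜.surf_face_lt_top hij.1) fun x hx => ?_
  have h2 := 𝓜.norm_sub_le_size hx.1 hp.1
  have h3 := 𝓜.norm_sub_le_size hp.1 hx.1
  have h0 : 0 ≤ 𝓜.size := (norm_nonneg _).trans h2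
  have h4 : ‖⟪u x - u p, n⟫‖ ≤ L * 𝓜.size := by
    refine (norm_inner_le_norm _ _).trans ?_
    rw [hn, mul_one]
    refine (hu.norm_sub_le hx.1 hp.1).trans ?_
    gcongr
  have h5 : ‖g (p - x)‖ ≤ B * 𝓜.size := (g.le_opNorm _).trans (by gcongr)
  rw [norm_mul]
  calc _ ≤ (L * 𝓜.size) * (B * 𝓜.size) := by gcongr
    _ = _ := by ring

lemma lipschitzOnWith_smul {i : Fin 𝓜.N} (hu : LipschitzOnWith L u (𝓜.cell i))
    (hU : ∀ x ∈ M, ‖u x‖ ≤ U) (g : Euc d →L[ℝ] ℝ) {y : Euc d} (hy : y ∈ 𝓜.cell i) :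
    ∃ K : ℝ≥0, LipschitzOnWith K (fun x => g (x - y) • u x) (𝓜.cell i) := by
  have hU0 : 0 ≤ U := (norm_nonneg _).trans (hU y (𝓜.cell_subset i hy))
  have h0 : 0 ≤ 𝓜.size := (norm_nonneg _).trans (𝓜.norm_sub_le_size hy hy)
  refine ⟨(‖g‖ * 𝓜.size * L + ‖g‖ * U).toNNReal, LipschitzOnWith.of_dist_le_mul fun a ha b hb => ?_⟩
  rw [Real.coe_toNNReal _ (by positivity), dist_eq_norm, dist_eq_norm]
  have h1 : g (a - y) • u a - g (b - y) • u b = g (a - y) • (u a - u b) + g (a - b) • u b := by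
    have : g (a - b) = g (a - y) - g (b - y) := by rw [← map_sub]; congr 1; abel
    rw [this]
    module
  rw [h1]
  refine (norm_add_le _ _).trans ?_
  rw [norm_smul, norm_smul]
  have h2 : ‖g (a - y)‖ ≤ ‖g‖ * 𝓜.size :=
    (g.le_opNorm _).trans (by gcongr; exact 𝓜.norm_sub_le_size ha hy)
  have h3 : ‖g (a - b)‖ ≤ ‖g‖ * ‖a - b‖ := g.le_opNorm _
  have h4 := hu.norm_sub_le ha hb
  have h5 := hU b (𝓜.cell_subset i hb)
  calc _ ≤ (‖g‖ * 𝓜.size) * (L * ‖a - b‖) + (‖g‖ * ‖a - b‖) * U := by gcongr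
    _ = _ := by ring

/-- By the product rule the integrand is `g(x - y) div u + g(u x)`. The first term is at most `d B L
h`, as `|div u| ≤ d L`, and replacing `u x` by `u y` costs `B L h`. -/
lemma abs_integral_divergence_smul_sub_le {i : Fin 𝓜.N} (hu : LipschitzOnWith L u (𝓜.cell i))
    (hB0 : 0 ≤ B) {g : Euc d →L[ℝ] ℝ} (hg : ‖g‖ ≤ B) {y : Euc d} (hy : y ∈ 𝓜.cell i) :
    |(∫ x in 𝓜.cell i, divergence (fun x => g (x - y) • u x) x) - 𝓜.vol i * g (u y)| ≤
      (d + 1) * B * L * 𝓜.size * 𝓜.vol i := by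
  have hfin := (𝓜.isCompact_cell i).measure_lt_top (μ := volume)
  obtain ⟨S, c, h⟩ := (𝓜.polytope i).exists_isPolytopeWith
  have h0 : 0 ≤ 𝓜.size := (norm_nonneg _).trans (𝓜.norm_sub_le_size hy hy)
  have hmeas : Measurable fun x => divergence u x := by
    simp_rw [divergence_eq_sum]
    refine Finset.measurable_sum _ fun k _ => ?_
    exact (EuclideanSpace.proj (𝕜 := ℝ) k).measurable.comp (measurable_fderiv_apply_const ℝ u _)
  have hdivi : IntegrableOn (divergence u) (𝓜.cell i) := by
    have : IsFiniteMeasure (volume.restrict (𝓜.cell i)) := ⟨by simpa using hfin⟩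
    refine Integrable.of_bound hmeas.aestronglyMeasurable (d * L) ?_
    filter_upwards [h.ae_mem_interior] with x hx using abs_divergence_le hu hx
  have hae : ∀ᵐ x ∂volume.restrict (𝓜.cell i), divergence (fun x => g (x - y) • u x) x =
      g (x - y) * divergence u x + g (u x) := by
    filter_upwards [h.ae_differentiableAt hu] with x hx using divergence_smul hx.2 g y
  have hi1 : IntegrableOn (fun x => g (x - y) * divergence u x + g (u x)) (𝓜.cell i) := by
    refine Integrable.add ?_ (𝓜.integrableOn_cell (g.continuous.comp_continuousOn hu.continuousOn))
    exact hdivi.continuousOn_mul (by fun_prop) (𝓜.isCompact_cell i)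
  have hc : IntegrableOn (fun _ : Euc d => g (u y)) (𝓜.cell i) := integrableOn_const hfin.ne
  have h1 : 𝓜.vol i * g (u y) = ∫ x in 𝓜.cell i, g (u y) := by
    rw [setIntegral_const, ← vol, smul_eq_mul]
  rw [integral_congr_ae hae, h1, ← integral_sub hi1 hc]
  refine norm_setIntegral_le_of_norm_le_const_ae'
    (f := fun x => g (x - y) * divergence u x + g (u x) - g (u y)) hfin ?_
  have hint := (ae_restrict_iff' (𝓜.isClosed_cell i).measurableSet).1 h.ae_mem_interior
  filter_upwards [hint] with x hx hxi
  have h2 := abs_divergence_le hu (hx hxi)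
  have h3 : |g (x - y)| ≤ B * 𝓜.size :=
    (g.le_opNorm _).trans (mul_le_mul hg (𝓜.norm_sub_le_size hxi hy) (norm_nonneg _) hB0)
  have h4 : |g (u x - u y)| ≤ B * (L * 𝓜.size) := by
    refine (g.le_opNorm _).trans (mul_le_mul hg ?_ (norm_nonneg _) hB0)
    refine (hu.norm_sub_le hxi hy).trans ?_
    gcongr
    exact 𝓜.norm_sub_le_size hxi hy
  have h5 : g (x - y) * divergence u x + g (u x) - g (u y) =
      g (x - y) * divergence u x + g (u x - u y) := by rw [map_sub g (u x)]; ring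
  rw [h5, Real.norm_eq_abs]
  refine (abs_add_le _ _).trans ?_
  rw [abs_mul]
  calc _ ≤ (B * 𝓜.size) * (d * L) + B * (L * 𝓜.size) := by gcongr
    _ = _ := by ring

end Flux

end Mesh

/-! ### The consistency estimate on one cell and in the supremum norm -/

namespace Mesh

variable {M : Set (Euc d)} (𝓜 : Mesh M)

open Classical in
lemma abs_velocityMatrix_proj_le {u : Euc d → Euc d} {L : ℝ≥0} {f : Euc d → ℝ}
    {f' : Euc d → Euc d →L[ℝ] ℝ} {U B K A P : ℝ}
    (hu : ∀ i, LipschitzOnWith L u (𝓜.cell i)) (hut : TangentToBoundary M u)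
    (hU : ∀ x ∈ M, ‖u x‖ ≤ U) (hK0 : 0 ≤ K)
    (hf : ∀ j, ∀ x ∈ 𝓜.cell j, HasFDerivWithinAt f (f' x) (𝓜.cell j) x)
    (hK : ∀ j, ∀ x ∈ 𝓜.cell j, ∀ y ∈ 𝓜.cell j, ‖f' x - f' y‖ ≤ K * ‖x - y‖)
    (hB0 : 0 ≤ B) (hB : ∀ x ∈ M, ‖f' x‖ ≤ B) {i : Fin 𝓜.N}
    (hA : 𝓜.size * ∑ j with 𝓜.Adj i j, (surf d).real (𝓜.face i j) ≤ A * 𝓜.vol i)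
    (hP0 : 0 ≤ P)
    (hP : ∀ j, 𝓜.Adj i j →
      ‖(1 / 2 : ℝ) • (𝓜.cellBary i + 𝓜.cellBary j) - 𝓜.faceBary i j‖ ≤ 𝓜.size * P)
    {x : Euc d} (hx : x ∈ 𝓜.cell i) :
    |(𝓜.velocityMatrix u *ᵥ 𝓜.proj f) i - -(f' x (u x))| ≤
      A * (U * (2 * K * 𝓜.size + B * P) + L * B * 𝓜.size) + (d + 1) * B * L * 𝓜.size +
        (K * U * 𝓜.size + B * L * 𝓜.size) := by
  set y := 𝓜.cellBary i with hy
  have hyi : y ∈ 𝓜.cell i := 𝓜.cellBary_mem i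
  have hyM := 𝓜.cell_subset i hyi
  have hxM := 𝓜.cell_subset i hx
  have hU0 : 0 ≤ U := (norm_nonneg _).trans (hU y hyM)
  have h0 : 0 ≤ 𝓜.size := (norm_nonneg _).trans (𝓜.norm_sub_le_size hyi hyi)
  set g := f' y with hg
  have hgB : ‖g‖ ≤ B := hB y hyM
  set w : Euc d → Euc d := fun x => g (x - y) • u x with hw
  obtain ⟨Kw, hwL⟩ := 𝓜.lipschitzOnWith_smul (hu i) hU g hyi
  -- A scalar multiple of a tangent field is tangent, so the divergence theorem on the cell applies
  -- to `w` too.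
  have hwt : TangentToBoundary M w := fun z n hzn => by
    rw [hw]
    simp only [real_inner_smul_left, hut z n hzn, mul_zero]
  have hV := 𝓜.vol_pos i
  have hdiv := 𝓜.integral_divergence_cell i hwL hwt
  have hbulk := 𝓜.abs_integral_divergence_smul_sub_le (hu i) hB0 hgB hyi
  rw [← hw, hdiv] at hbulk
  set s : Fin 𝓜.N → ℝ := fun j => (surf d).real (𝓜.face i j) with hs
  set Q : ℝ := U * (2 * K * 𝓜.size + B * P) + L * B * 𝓜.size with hQ
  have hQ0 : 0 ≤ Q := by positivity
  -- Each hyperface contributes at most `2 Q h` times its area: the Taylor error weighted by the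
  -- flux, plus twice the error of moving `g` inside the flux. Then `hA` absorbs `h` times the total
  -- area.
  have hsum : |∑ j with 𝓜.Adj i j, 𝓜.flux u i j * (𝓜.proj f j - 𝓜.proj f i) -
      2 * ∑ j with 𝓜.Adj i j, 𝓜.flux w i j| ≤ 2 * Q * (A * 𝓜.vol i) := by
    rw [Finset.mul_sum, ← Finset.sum_sub_distrib]
    calc _ ≤ ∑ j with 𝓜.Adj i j, 2 * Q * 𝓜.size * s j := by
          refine (Finset.abs_sum_le_sum_abs _ _).trans (Finset.sum_le_sum fun j hj => ?_)
          have hadj : 𝓜.Adj i j := (Finset.mem_filter.1 hj).2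
          have h1 := 𝓜.abs_proj_sub_proj_le hK0 hf hK hB0 hB hadj (hP j hadj)
          have h2 := 𝓜.abs_flux_le hadj.1 hU
          have h3 := 𝓜.abs_flux_mul_sub_le hadj (hu i) hB0 hgB y
          have h4 : 𝓜.flux u i j * (𝓜.proj f j - 𝓜.proj f i) - 2 * 𝓜.flux w i j =
              𝓜.flux u i j * (𝓜.proj f j - 𝓜.proj f i - 2 * g (𝓜.faceBary i j - y)) +
                2 * (𝓜.flux u i j * g (𝓜.faceBary i j - y) - 𝓜.flux w i j) := by ring
          rw [h4]
          refine (abs_add_le _ _).trans ?_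
          rw [abs_mul, abs_mul, abs_two]
          calc _ ≤ (U * s j) * (4 * K * 𝓜.size ^ 2 + 2 * B * (𝓜.size * P)) +
                2 * (L * B * 𝓜.size ^ 2 * s j) := by gcongr
            _ = _ := by rw [hQ]; ring
      _ = 2 * Q * (𝓜.size * ∑ j with 𝓜.Adj i j, s j) := by rw [← Finset.mul_sum]; ring
      _ ≤ _ := by gcongr
  have hmain := 𝓜.velocityMatrix_mulVec_eq_sum hu hut (𝓜.proj f) i
  set a := (𝓜.velocityMatrix u *ᵥ 𝓜.proj f) i with ha
  have h5 : |a + g (u y)| ≤ A * Q + (d + 1) * B * L * 𝓜.size := by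
    have h6 : |2 * 𝓜.vol i * (a + g (u y))| ≤
        2 * 𝓜.vol i * (A * Q + (d + 1) * B * L * 𝓜.size) := by
      rw [mul_add, hmain]
      rw [abs_le] at hsum hbulk ⊢
      constructor <;> linarith [hsum.1, hsum.2, hbulk.1, hbulk.2]
    rw [abs_mul, abs_of_pos (by positivity)] at h6
    exact le_of_mul_le_mul_left h6 (by positivity)
  have h7 : |(f' x - g) (u x)| ≤ K * U * 𝓜.size := by
    calc |(f' x - g) (u x)| ≤ ‖f' x - g‖ * ‖u x‖ := (f' x - g).le_opNorm _
      _ ≤ (K * 𝓜.size) * U := by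
          gcongr
          · exact (hK i x hx y hyi).trans (by gcongr; exact 𝓜.norm_sub_le_size hx hyi)
          · exact hU x hxM
      _ = _ := by ring
  have h8 : |g (u x - u y)| ≤ B * L * 𝓜.size := by
    calc |g (u x - u y)| ≤ ‖g‖ * ‖u x - u y‖ := g.le_opNorm _
      _ ≤ B * (L * 𝓜.size) := by
          gcongr
          refine ((hu i).norm_sub_le hx hyi).trans ?_
          gcongr
          exact 𝓜.norm_sub_le_size hx hyi
      _ = _ := by ring
  have h9 : a - -(f' x (u x)) = (a + g (u y)) + (f' x - g) (u x) + g (u x - u y) := by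
    simp only [map_sub, sub_apply]
    ring
  rw [h9]
  rw [abs_le] at h5 h7 h8 ⊢
  constructor <;> linarith [h5.1, h5.2, h7.1, h7.2, h8.1, h8.2]

/-- Another cell containing `x` would have interior points near `x`, inside cell `i`. So the choice
in `recon` matters only on the cell boundaries, a null set. -/
lemma recon_of_mem_interior (F : Fin 𝓜.N → ℝ) {i : Fin 𝓜.N} {x : Euc d}
    (hx : x ∈ interior (𝓜.cell i)) : 𝓜.recon F x = F i := by
  have hex : ∃ i, x ∈ 𝓜.cell i := ⟨i, interior_subset hx⟩
  rw [recon, dif_pos hex]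
  congr 1
  by_contra hne
  have hmem := hex.choose_spec
  rw [← 𝓜.closure_interior_cell] at hmem
  obtain ⟨z, hz1, hz2⟩ := mem_closure_iff.1 hmem _ isOpen_interior hx
  exact disjoint_left.1 (𝓜.disjoint_interior _ _ hne) hz2 hz1

lemma consistencyError_le {u : Euc d → Euc d} {f : Euc d → ℝ} {r : ℝ}
    (h : ∀ i, ∀ x ∈ 𝓜.cell i,
      |(𝓜.velocityMatrix u *ᵥ 𝓜.proj f) i - -(fderivWithin ℝ f M x (u x))| ≤ r) :
    𝓜.consistencyError u f ≤ ENNReal.ofReal r := by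
  rw [consistencyError, eLpNorm_exponent_top]
  refine eLpNormEssSup_le_of_ae_bound ?_
  have hM : volume.restrict M = volume.restrict (⋃ i, 𝓜.cell i) := by rw [𝓜.cover]
  rw [hM]
  refine (ae_restrict_iUnion_iff _ _).2 fun i => ?_
  obtain ⟨S, c, hC⟩ := (𝓜.polytope i).exists_isPolytopeWith
  filter_upwards [hC.ae_mem_interior] with x hx
  rw [𝓜.recon_of_mem_interior _ hx]
  exact h i x (interior_subset hx)

/-- The derivative of a `C²` function is bounded, and Lipschitz on the cells of all meshes. -/
lemma exists_bounds_fderivWithin (𝓜₀ : Mesh M) {f : Euc d → ℝ} (hf : ContDiffOn ℝ 2 f M) :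
    ∃ B K : ℝ, 0 ≤ B ∧ 0 ≤ K ∧ (∀ x ∈ M, ‖fderivWithin ℝ f M x‖ ≤ B) ∧
      ∀ (𝓜 : Mesh M) (i : Fin 𝓜.N), ∀ x ∈ 𝓜.cell i, ∀ y ∈ 𝓜.cell i,
        ‖fderivWithin ℝ f M x - fderivWithin ℝ f M y‖ ≤ K * ‖x - y‖ := by
  have hM := 𝓜₀.uniqueDiffOn
  have hf1 : ContDiffOn ℝ 1 (fderivWithin ℝ f M) M := hf.fderivWithin hM (by norm_num)
  obtain ⟨B, hB⟩ := 𝓜₀.isCompact.exists_bound_of_continuousOn hf1.continuousOn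
  obtain ⟨K, hK⟩ := 𝓜₀.isCompact.exists_bound_of_continuousOn
    (hf1.continuousOn_fderivWithin hM (by norm_num))
  refine ⟨max B 0, max K 0, le_max_right _ _, le_max_right _ _,
    fun x hx => (hB x hx).trans (le_max_left _ _), fun 𝓜 i x hx y hy => ?_⟩
  refine (𝓜.convex_cell i).norm_image_sub_le_of_norm_hasFDerivWithin_le
    (fun z hz => ?_) (fun z hz => (hK z (𝓜.cell_subset i hz)).trans (le_max_left _ _)) hy hx
  exact ((hf1.differentiableOn (by norm_num)) z (𝓜.cell_subset i hz)).hasFDerivWithinAt.mono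
    (𝓜.cell_subset i)

end Mesh

/-! ### Consequences of quasi-uniformity -/

lemma le_diam_of_closedBall_subset (hd : 1 ≤ d) {C : Set (Euc d)} (hb : Bornology.IsBounded C)
    {x : Euc d} {r : ℝ} (hr : 0 ≤ r) (h : Metric.closedBall x (r / 2) ⊆ C) :
    r ≤ Metric.diam C := by
  set e : Euc d := EuclideanSpace.single ⟨0, hd⟩ 1 with he
  have hen : ‖e‖ = 1 := by simp [he]
  have h1 : x + (r / 2) • e ∈ C := h (by
    rw [Metric.mem_closedBall, dist_self_add_left, norm_smul, hen, mul_one,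
      Real.norm_of_nonneg (by positivity)])
  have h2 : x - (r / 2) • e ∈ C := h (by
    rw [Metric.mem_closedBall, dist_self_sub_left, norm_smul, hen, mul_one,
      Real.norm_of_nonneg (by positivity)])
  have h3 := Metric.dist_le_diam_of_mem hb h1 h2
  have h4 : x + (r / 2) • e - (x - (r / 2) • e) = r • e := by module
  rwa [dist_eq_norm, h4, norm_smul, hen, mul_one, Real.norm_of_nonneg hr] at h3

/-- A convex body contains a ball whose radius is a quarter of the inscribed diameter. -/
lemma IsConvexBodyPolytope.exists_closedBall_subset (hd : 1 ≤ d) {C : Set (Euc d)}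
    (hC : IsConvexBodyPolytope C) :
    0 < inscribedDiam C ∧ ∃ z, Metric.closedBall z (inscribedDiam C / 4) ⊆ C := by
  have hbdd : BddAbove {ρ : ℝ | 0 ≤ ρ ∧ ∃ x, Metric.closedBall x (ρ / 2) ⊆ C} :=
    ⟨Metric.diam C, fun ρ hρ => by
      obtain ⟨h0, x, hx⟩ := hρ
      exact le_diam_of_closedBall_subset hd hC.1 h0 hx⟩
  obtain ⟨x, hx⟩ := hC.2.1
  obtain ⟨ε, hε, hball⟩ := Metric.nhds_basis_closedBall.mem_iff.1 (mem_interior_iff_mem_nhds.1 hx)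
  have hmem : 2 * ε ∈ {ρ : ℝ | 0 ≤ ρ ∧ ∃ x, Metric.closedBall x (ρ / 2) ⊆ C} :=
    ⟨by positivity, x, by rwa [mul_div_cancel_left₀ _ (two_ne_zero' ℝ)]⟩
  have hpos : 0 < inscribedDiam C := lt_of_lt_of_le (by positivity) (le_csSup hbdd hmem)
  refine ⟨hpos, ?_⟩
  -- No maximizer is needed: some admissible diameter exceeds half the supremum, which explains the
  -- quarter.
  obtain ⟨ρ, ⟨-, z, hz⟩, hlt⟩ := exists_lt_of_lt_csSup ⟨_, hmem⟩
    (show inscribedDiam C / 2 < sSup _ from half_lt_self hpos)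
  exact ⟨z, (Metric.closedBall_subset_closedBall (by linarith)).trans hz⟩

-- The radius `ρ/4` of a ball in the cell satisfies `h ≤ |γ| |σ| ρ`, so the area bound from that
-- ball gives `A = 4 |γ| |σ| d`.
open Classical in
lemma QuasiUniform.exists_size_mul_sum_surf_le (hd : 1 ≤ d) {M : Set (Euc d)} {H : Type*}
    {mesh : H → Mesh M} (hqu : QuasiUniform mesh) :
    ∃ A : ℝ, 0 ≤ A ∧ ∀ h i, (mesh h).size *
      ∑ j with (mesh h).Adj i j, (surf d).real ((mesh h).face i j) ≤ A * (mesh h).vol i := by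
  obtain ⟨⟨σ, hσ⟩, γ, hγ⟩ := hqu
  refine ⟨4 * (|γ| * |σ|) * d, by positivity, fun h i => ?_⟩
  obtain ⟨hρ, z, hz⟩ := ((mesh h).polytope i).exists_closedBall_subset hd
  set ρ := inscribedDiam ((mesh h).cell i)
  have hdiam : 0 < Metric.diam ((mesh h).cell i) :=
    lt_of_lt_of_le (half_pos hρ) (le_diam_of_closedBall_subset hd ((mesh h).polytope i).1
      (half_pos hρ).le (by convert hz using 2; ring))
  have h1 : Metric.diam ((mesh h).cell i) ≤ |σ| * ρ :=
    (div_le_iff₀ hρ).1 ((hσ h i).trans (le_abs_self σ))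
  have h2 : (mesh h).size ≤ |γ| * Metric.diam ((mesh h).cell i) :=
    (div_le_iff₀ hdiam).1 ((hγ h i).trans (le_abs_self γ))
  have h3 := (mesh h).mul_sum_surf_face_le i (by positivity) hz
  set s := ∑ j with (mesh h).Adj i j, (surf d).real ((mesh h).face i j)
  have hs : 0 ≤ s := Finset.sum_nonneg fun _ _ => measureReal_nonneg
  calc (mesh h).size * s ≤ (|γ| * (|σ| * ρ)) * s := by
        gcongr
        exact h2.trans (by gcongr)
    _ = 4 * (|γ| * |σ|) * (ρ / 4 * s) := by ring
    _ ≤ 4 * (|γ| * |σ|) * (d * (mesh h).vol i) := by gcongr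
    _ = _ := by ring

/-- The velocity matrices are consistent with the Lie derivative of functions, with an error that is
controlled by the mesh size. -/
theorem exists_consistencyError_le (hd : 1 ≤ d) {M : Set (Euc d)} {H : Type*} [Nonempty H]
    {mesh : H → Mesh M} (hqu : QuasiUniform mesh) {α : ℝ} (hα : 0 ≤ α)
    (hpar : ApproxParallelogram mesh α) {u : Euc d → Euc d} {L : ℝ≥0}
    (hu : ∀ h i, LipschitzOnWith L u ((mesh h).cell i)) (huc : ContinuousOn u M)
    (hut : TangentToBoundary M u) {f : Euc d → ℝ} (hf : ContDiffOn ℝ 2 f M) :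
    ∃ C : ℝ, ∀ h, (mesh h).consistencyError u f ≤
      ENNReal.ofReal (C * ((mesh h).size + (mesh h).size ^ α)) := by
  obtain ⟨h₀⟩ := ‹Nonempty H›
  obtain ⟨A, hA0, hA⟩ := hqu.exists_size_mul_sum_surf_le hd
  obtain ⟨B, K, hB0, hK0, hB, hK⟩ := (mesh h₀).exists_bounds_fderivWithin hf
  obtain ⟨U', hU'⟩ := (mesh h₀).isCompact.exists_bound_of_continuousOn huc
  set U := max U' 0 with hUdef
  have hU0 : 0 ≤ U := le_max_right _ _
  have hU : ∀ x ∈ M, ‖u x‖ ≤ U := fun x hx => (hU' x hx).trans (le_max_left _ _)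
  obtain ⟨lam, hlam⟩ := hpar
  refine ⟨A * (U * (2 * K + B * |lam|) + L * B) + (d + 1) * B * L + (K * U + B * L), fun h => ?_⟩
  refine (mesh h).consistencyError_le fun i x hx => ?_
  have hs0 : 0 ≤ (mesh h).size := Metric.diam_nonneg.trans ((mesh h).diam_cell_le_size i)
  have hsα : 0 ≤ (mesh h).size ^ α := Real.rpow_nonneg hs0 α
  have hP : ∀ j, (mesh h).Adj i j →
      ‖(1 / 2 : ℝ) • ((mesh h).cellBary i + (mesh h).cellBary j) - (mesh h).faceBary i j‖ ≤
        (mesh h).size * (|lam| * (mesh h).size ^ α) := fun j hj => by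
    refine (hlam h i j hj).trans ?_
    rw [Real.rpow_add_of_nonneg hs0 zero_le_one hα, Real.rpow_one]
    calc lam * ((mesh h).size * (mesh h).size ^ α)
        ≤ |lam| * ((mesh h).size * (mesh h).size ^ α) := by gcongr; exact le_abs_self lam
      _ = _ := by ring
  refine ((mesh h).abs_velocityMatrix_proj_le (hu h) hut hU hK0 (fun j z hz => ?_)
    (hK (mesh h)) hB0 hB (hA h i) (by positivity) hP hx).trans ?_
  · exact ((hf.differentiableOn (by norm_num)) z
      ((mesh h).cell_subset j hz)).hasFDerivWithinAt.mono ((mesh h).cell_subset j)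
  · set s := (mesh h).size
    set t := s ^ α
    -- One constant multiplies both `h` and `h^α`; these are the nonnegative surplus terms that this
    -- adds to the sharper bound.
    have h1 : 0 ≤ A * U * (2 * K) * t := by positivity
    have h2 : 0 ≤ A * U * (B * |lam|) * s := by positivity
    have h3 : 0 ≤ (A * (L * B) + (d + 1) * B * L + (K * U + B * L)) * t := by positivity
    linarith

end DiscreteFlow

end

theorem mainTheorem5 {d : ℕ} (hd : 1 ≤ d) (M : Set (DiscreteFlow.Euc d))
    (H : Set ℝ) (mesh : H → DiscreteFlow.Mesh M) (hsize : ∀ h : H, (mesh h).size = (h : ℝ))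
    (hqu : DiscreteFlow.QuasiUniform mesh)
    (α : ℝ) (hα : 1 ≤ α) (hpar : DiscreteFlow.ApproxParallelogram mesh α)
    (u : DiscreteFlow.Euc d → DiscreteFlow.Euc d)
    (hu : DiscreteFlow.MemW2Infty (interior M) u) (hucont : ContinuousOn u M)
    (hutan : DiscreteFlow.TangentToBoundary M u) :
    (∀ h : H, (mesh h).velocityMatrix u ∈ (mesh h).sparse) ∧
    ∀ f : DiscreteFlow.Euc d → ℝ, ContDiffOn ℝ 2 f M →
      Tendsto (fun h : H => (mesh h).consistencyError u f)
        (comap (fun h : H => (h : ℝ)) (𝓝[>] 0)) (𝓝 0) ∧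
      ∃ C : ℝ, ∀ h : H,
        (mesh h).consistencyError u f ≤ ENNReal.ofReal (C * ((h : ℝ) + (h : ℝ) ^ α)) := by
  obtain ⟨L, hL⟩ := hu.exists_lipschitzOnWith_cell hucont
  refine ⟨fun h => (mesh h).velocityMatrix_mem_sparse (hL (mesh h)) hutan, fun f hf => ?_⟩
  have hα0 : 0 ≤ α := zero_le_one.trans hα
  obtain ⟨C, hC⟩ : ∃ C : ℝ, ∀ h : H,
      (mesh h).consistencyError u f ≤ ENNReal.ofReal (C * ((h : ℝ) + (h : ℝ) ^ α)) := by
    -- The bounds on `u` and on the derivatives of `f` use compactness of `M`, which is read off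
    -- from some mesh of the family.
    rcases isEmpty_or_nonempty H with hH | hH
    · exact ⟨0, fun h => hH.elim h⟩
    · obtain ⟨C, hC⟩ := DiscreteFlow.exists_consistencyError_le hd hqu hα0 hpar
        (fun h => hL (mesh h)) hucont hutan hf
      exact ⟨C, fun h => by rw [← hsize h]; exact hC h⟩
  refine ⟨?_, C, hC⟩
  have h1 : Tendsto (fun t : ℝ => ENNReal.ofReal (C * (t + t ^ α))) (𝓝[>] 0) (𝓝 0) := by
    have h2 : ContinuousAt (fun t : ℝ => C * (t + t ^ α)) 0 :=
      (continuousAt_id.add (Real.continuousAt_rpow_const 0 α (Or.inr hα0))).const_mul C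
    have h3 := (ENNReal.continuous_ofReal.tendsto _).comp h2.tendsto
    rw [Real.zero_rpow (zero_lt_one.trans_le hα).ne', add_zero, mul_zero,
      ENNReal.ofReal_zero] at h3
    exact h3.mono_left nhdsWithin_le_nhds
  exact tendsto_of_tendsto_of_tendsto_of_le_of_le tendsto_const_nhds (h1.comp tendsto_comap)
    (fun _ => zero_le) hC
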